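/- Let $\mathrm{Homeo}_+(\mathbb R^2)$ be the group of orientation preserving homeomorphisms of $\mathbb R^2=\mathbb C$. For $f\in\mathrm{Homeo}_+(\mathbb R^2)$, a lift of $f$ at infinity is the germ at $\operatorname{Re} w\to+\infty$ of a continuous map $F$, defined on a half plane $\{\operatorname{Re} w>R\}$, with $\exp(F(w))=f(\exp(w))$. The pairs $(f,F)$ form a group under composition, which is a central extension $$\mathbb Z\to\widetilde{\mathrm{Homeo}}_+(\mathbb R^2)\to\mathrm{Homeo}_+(\mathbb R^2),$$ where $k\in\mathbb Z$ acts as the deck transformation $w\mapsto w+2\pi i k$. Let $e\in H^2(\mathrm{Homeo}_+(\mathbb R^2);\mathbb Z)$ (group cohomology) be the class of this extension, the Euler class. For $g\ge 1$ let $S_g$ be the closed orientable surface of genus $g$, and let $[S_g]$ be a generator of $H_2(\pi_1(S_g);\mathbb Z)\cong\mathbb Z$ (either of the two, i.e. either orientation of $S_g$). **Theorem.** For every $g\ge 1$ and every $n\in\mathbb Z$ there is a homomorphism $\rho:\pi_1(S_g)\to\mathrm{Homeo}_+(\mathbb R^2)$ with $\rho^*e([S_g])=n$. -/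

import Mathlib

open Filter Topology
open scoped CategoryTheory

noncomputable section

/-! ### Orientation preserving homeomorphisms of the plane

The plane `ℝ²` is the complex plane `ℂ`. -/

/-- The deck translation `2πi` of the universal covering `exp : ℂ → ℂ ∖ {0}`. -/
def deckPeriod : ℂ := 2 * (Real.pi : ℂ) * Complex.I

/-- A homeomorphism `f` of the plane preserves orientation if it has local degree `1` at each
point `p`: the map `z ↦ f (p + z) - f p` of `ℂ ∖ {0}` to itself acts trivially on
`π₁(ℂ ∖ {0}) = ℤ`, i.e. it lifts to a map `F` of the universal covering `exp : ℂ → ℂ ∖ {0}`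
with `F (w + 2πi) = F w + 2πi`. -/
def PreservesOrientation (f : ℂ ≃ₜ ℂ) : Prop :=
  ∀ p : ℂ, ∃ F : ℂ → ℂ, Continuous F ∧
    (∀ w, Complex.exp (F w) = f (p + Complex.exp w) - f p) ∧
    ∀ w, F (w + deckPeriod) = F w + deckPeriod

lemma deckPeriod_ne_zero : deckPeriod ≠ 0 := by
  simp [deckPeriod, Real.pi_ne_zero]

lemma exp_add_int_mul_deckPeriod (w : ℂ) (k : ℤ) :
    Complex.exp (w + k * deckPeriod) = Complex.exp w := by
  rw [Complex.exp_add, deckPeriod, Complex.exp_int_mul_two_pi_mul_I, mul_one]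

lemma exp_add_deckPeriod (w : ℂ) : Complex.exp (w + deckPeriod) = Complex.exp w := by
  simpa using exp_add_int_mul_deckPeriod w 1

/-- Two continuous functions on a connected set with the same exponential differ by a constant
multiple of `2πi`. -/
lemma exists_int_of_exp_eq {s : Set ℂ} (hs : IsPreconnected s) {F G : ℂ → ℂ}
    (hF : ContinuousOn F s) (hG : ContinuousOn G s)
    (h : ∀ w ∈ s, Complex.exp (F w) = Complex.exp (G w)) :
    ∃ k : ℤ, ∀ w ∈ s, F w = G w + k * deckPeriod := by
  rcases s.eq_empty_or_nonempty with rfl | ⟨w₀, hw₀⟩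
  · exact ⟨0, by simp⟩
  have key : ∀ w ∈ s, ∃ n : ℤ, F w = G w + n * deckPeriod := fun w hw =>
    Complex.exp_eq_exp_iff_exists_int.1 (h w hw)
  let φ : ℂ → ℝ := fun w => ((F w - G w) / deckPeriod).re
  have hφ : ContinuousOn φ s :=
    Complex.continuous_re.comp_continuousOn ((hF.sub hG).div_const _)
  have hval : ∀ w ∈ s, ∀ n : ℤ, F w = G w + n * deckPeriod → φ w = n := by
    intro w _ n hn
    simp [φ, hn, deckPeriod_ne_zero]
  obtain ⟨k, hk⟩ := key w₀ hw₀
  refine ⟨k, fun w hw => ?_⟩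
  obtain ⟨n, hn⟩ := key w hw
  have hint : IsPreconnected (φ '' s) := hs.image φ hφ
  have hsub : φ '' s ⊆ Set.range ((↑) : ℤ → ℝ) := by
    rintro _ ⟨v, hv, rfl⟩
    obtain ⟨m, hm⟩ := key v hv
    exact ⟨m, (hval v hv m hm).symm⟩
  have hsing : (φ '' s).Subsingleton := by
    have hoc := hint.ordConnected
    rintro _ ⟨v, hv, rfl⟩ _ ⟨u, hu, rfl⟩
    obtain ⟨a, ha⟩ := hsub ⟨v, hv, rfl⟩
    obtain ⟨b, hb⟩ := hsub ⟨u, hu, rfl⟩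
    have aux : ∀ a b : ℤ, (a : ℝ) ∈ φ '' s → (b : ℝ) ∈ φ '' s → ¬ a < b := by
      intro a b ha hb hab
      have hab' : (a : ℝ) + 1 ≤ b := by exact_mod_cast hab
      obtain ⟨c, hc⟩ := hsub (hoc.out ha hb
        (show (a : ℝ) + 1 / 2 ∈ Set.Icc (a : ℝ) b from ⟨by linarith, by linarith⟩))
      have h1 : a < c := by
        have : (a : ℝ) < c := by rw [hc]; linarith
        exact_mod_cast this
      have h2 : c < a + 1 := by
        have : (c : ℝ) < a + 1 := by rw [hc]; linarith
        exact_mod_cast this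
      omega
    have hav : (a : ℝ) ∈ φ '' s := ha ▸ ⟨v, hv, rfl⟩
    have hbu : (b : ℝ) ∈ φ '' s := hb ▸ ⟨u, hu, rfl⟩
    have hab : a = b := le_antisymm (not_lt.1 (aux b a hbu hav)) (not_lt.1 (aux a b hav hbu))
    rw [← ha, ← hb, hab]
  have hnk : (n : ℝ) = k := by
    rw [← hval w hw n hn, ← hval w₀ hw₀ k hk]
    exact hsing ⟨w, hw, rfl⟩ ⟨w₀, hw₀, rfl⟩
  have hnk' : n = k := by exact_mod_cast hnk
  rw [hn, hnk']

lemma add_int_mul_deckPeriod {s : Set ℂ} (hs : ∀ w ∈ s, ∀ k : ℤ, w + k * deckPeriod ∈ s)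
    {F : ℂ → ℂ} (h : ∀ w ∈ s, F (w + deckPeriod) = F w + deckPeriod) (k : ℤ) :
    ∀ w ∈ s, F (w + k * deckPeriod) = F w + k * deckPeriod := by
  induction k using Int.induction_on with
  | zero => intro w _; simp
  | succ n ih =>
    intro w hw
    have h1 := h _ (hs w hw n)
    have h2 := ih w hw
    push_cast at *
    rw [show w + ((n : ℂ) + 1) * deckPeriod = w + n * deckPeriod + deckPeriod by ring, h1, h2]
    ring
  | pred n ih =>
    intro w hw
    have h1 := h _ (hs w hw (-n - 1))
    have h2 := ih w hw
    push_cast at *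
    rw [show w + (-(n : ℂ) - 1) * deckPeriod + deckPeriod = w + -n * deckPeriod by ring] at h1
    rw [h2] at h1
    linear_combination -h1

lemma preservesOrientation_one : PreservesOrientation 1 := fun p =>
  ⟨id, continuous_id, by simp, by simp⟩

lemma PreservesOrientation.mul {f g : ℂ ≃ₜ ℂ} (hf : PreservesOrientation f)
    (hg : PreservesOrientation g) : PreservesOrientation (f * g) := by
  intro p
  obtain ⟨G, hG, hGe, hGd⟩ := hg p
  obtain ⟨F, hF, hFe, hFd⟩ := hf (g p)
  refine ⟨F ∘ G, hF.comp hG, fun w => ?_, fun w => ?_⟩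
  · simp [hFe, hGe]
  · simp [hGd, hFd]

lemma PreservesOrientation.inv {f : ℂ ≃ₜ ℂ} (hf : PreservesOrientation f) :
    PreservesOrientation f⁻¹ := by
  intro q
  obtain ⟨F, hF, hFe, hFd⟩ := hf (f.symm q)
  have hne : ∀ w, f.symm (q + Complex.exp w) - f.symm q ≠ 0 := fun w h => by
    have := f.symm.injective (sub_eq_zero.1 h)
    simp at this
  obtain ⟨H, ⟨-, hHe⟩, -⟩ := Complex.isCoveringMapOn_exp.existsUnique_continuousMap_lifts
    (A := ℂ) ⟨fun w => f.symm (q + Complex.exp w) - f.symm q, by fun_prop⟩ (a₀ := 0)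
    (Complex.exp_log (hne 0)) (fun w => hne w)
  have hHe' : ∀ w, Complex.exp (H w) = f.symm (q + Complex.exp w) - f.symm q :=
    fun w => congrFun hHe w
  have hper : ∀ (k : ℤ) (w : ℂ), F (w + k * deckPeriod) = F w + k * deckPeriod := fun k w =>
    add_int_mul_deckPeriod (s := Set.univ) (by simp) (fun w _ => hFd w) k w trivial
  obtain ⟨k, hk⟩ := exists_int_of_exp_eq (F := fun w => F (H w)) (G := id)
    isPreconnected_univ (hF.comp H.continuous).continuousOn continuousOn_id
    (fun w _ => by simp [hFe, hHe'])
  obtain ⟨m, hm⟩ := exists_int_of_exp_eq (F := fun w => H (w + deckPeriod)) (G := H)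
    isPreconnected_univ (by fun_prop) (by fun_prop)
    (fun w _ => by rw [hHe', hHe', exp_add_deckPeriod])
  refine ⟨H, H.continuous, hHe', fun w => ?_⟩
  have h1 := hk (w + deckPeriod) trivial
  have h2 := hk w trivial
  have h3 := hm w trivial
  simp only [id] at h1 h2 h3
  rw [h3, hper, h2] at h1
  rw [h3]
  linear_combination h1

/-- The group `Homeo₊(ℝ²)` of orientation preserving homeomorphisms of the plane. -/
def HomeoPlus : Subgroup (ℂ ≃ₜ ℂ) where
  carrier := {f | PreservesOrientation f}
  one_mem' := preservesOrientation_one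
  mul_mem' := PreservesOrientation.mul
  inv_mem' := PreservesOrientation.inv

/-! ### Lifts of germs at infinity

A neighbourhood of infinity contains an annulus `A = {z | e ^ R < |z|}`, whose universal covering
is `exp : {w | R < re w} → A`. -/

/-- The end `re w → +∞` of the universal covering of the annuli `{z | e ^ R < |z|}`. -/
def coverInfinity : Filter ℂ := comap Complex.re atTop

/-- `F` is a lift of `f` to the universal covering of a punctured neighbourhood of infinity. -/
def IsLiftAtInfinity (f : ℂ ≃ₜ ℂ) (F : ℂ → ℂ) : Prop :=
  ∃ R : ℝ, ContinuousOn F {w | R < w.re} ∧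
    ∀ w : ℂ, R < w.re → Complex.exp (F w) = f (Complex.exp w)

lemma eventually_coverInfinity {P : ℂ → Prop} :
    (∀ᶠ w in coverInfinity, P w) ↔ ∃ R : ℝ, ∀ w : ℂ, R < w.re → P w := by
  simp [coverInfinity, ((atTop_basis_Ioi (α := ℝ)).comap Complex.re).eventually_iff]

lemma isPreconnected_halfPlane (R : ℝ) : IsPreconnected {w : ℂ | R < w.re} :=
  (convex_halfSpace_re_gt R).isPreconnected

lemma IsLiftAtInfinity.unique {f : ℂ ≃ₜ ℂ} {F G : ℂ → ℂ} (hF : IsLiftAtInfinity f F)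
    (hG : IsLiftAtInfinity f G) :
    ∃ k : ℤ, ∀ᶠ w in coverInfinity, F w = G w + k * deckPeriod := by
  obtain ⟨R, hFc, hFe⟩ := hF
  obtain ⟨S, hGc, hGe⟩ := hG
  obtain ⟨k, hk⟩ := exists_int_of_exp_eq (isPreconnected_halfPlane (max R S))
    (hFc.mono fun w (hw : max R S < w.re) => (max_lt_iff.1 hw).1)
    (hGc.mono fun w (hw : max R S < w.re) => (max_lt_iff.1 hw).2)
    (fun w hw => by rw [hFe w (max_lt_iff.1 hw).1, hGe w (max_lt_iff.1 hw).2])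
  exact ⟨k, eventually_coverInfinity.2 ⟨max R S, fun w hw => hk w hw⟩⟩

lemma tendsto_exp_coverInfinity : Tendsto Complex.exp coverInfinity (cocompact ℂ) := by
  rw [← Metric.cobounded_eq_cocompact, ← comap_norm_atTop, tendsto_comap_iff]
  simp only [Function.comp_def, Complex.norm_exp]
  exact Real.tendsto_exp_atTop.comp tendsto_comap

lemma IsLiftAtInfinity.tendsto {f : ℂ ≃ₜ ℂ} {F : ℂ → ℂ} (hF : IsLiftAtInfinity f F) :
    Tendsto F coverInfinity coverInfinity := by
  obtain ⟨R, -, hFe⟩ := hF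
  rw [coverInfinity, tendsto_comap_iff, ← coverInfinity]
  refine Real.tendsto_exp_comp_atTop.1 ?_
  have h : Tendsto (fun w => ‖f (Complex.exp w)‖) coverInfinity atTop :=
    tendsto_norm_cocompact_atTop.comp
      (f.isClosedEmbedding.tendsto_cocompact.comp tendsto_exp_coverInfinity)
  refine h.congr' (eventually_coverInfinity.2 ⟨R, fun w hw => ?_⟩)
  rw [← hFe w hw, Complex.norm_exp]
  rfl

lemma IsLiftAtInfinity.comp {f g : ℂ ≃ₜ ℂ} {F G : ℂ → ℂ} (hF : IsLiftAtInfinity f F)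
    (hG : IsLiftAtInfinity g G) : IsLiftAtInfinity (f * g) (F ∘ G) := by
  have ht := hG.tendsto
  obtain ⟨R, hFc, hFe⟩ := hF
  obtain ⟨S, hGc, hGe⟩ := hG
  obtain ⟨T, hT⟩ := eventually_coverInfinity.1
    (ht.eventually (eventually_coverInfinity.2 ⟨R, fun w hw => hw⟩))
  refine ⟨max S T, hFc.comp (hGc.mono fun w (hw : max S T < w.re) => (max_lt_iff.1 hw).1)
    fun w (hw : max S T < w.re) => hT w (max_lt_iff.1 hw).2, fun w hw => ?_⟩
  simp [hFe _ (hT w (max_lt_iff.1 hw).2), hGe w (max_lt_iff.1 hw).1]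

lemma isLiftAtInfinity_one : IsLiftAtInfinity 1 id :=
  ⟨0, continuousOn_id, by simp⟩

lemma IsLiftAtInfinity.add {f : ℂ ≃ₜ ℂ} {F : ℂ → ℂ} (hF : IsLiftAtInfinity f F) (k : ℤ) :
    IsLiftAtInfinity f (fun w => F w + k * deckPeriod) := by
  obtain ⟨R, hFc, hFe⟩ := hF
  exact ⟨R, hFc.add continuousOn_const, fun w hw => by
    rw [exp_add_int_mul_deckPeriod, hFe w hw]⟩

lemma IsLiftAtInfinity.congr {f : ℂ ≃ₜ ℂ} {F G : ℂ → ℂ} (hF : IsLiftAtInfinity f F)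
    (h : F =ᶠ[coverInfinity] G) : IsLiftAtInfinity f G := by
  obtain ⟨R, hFc, hFe⟩ := hF
  obtain ⟨S, hS⟩ := eventually_coverInfinity.1 h
  refine ⟨max R S, (hFc.mono fun w (hw : max R S < w.re) => (max_lt_iff.1 hw).1).congr
    fun w (hw : max R S < w.re) => (hS w (max_lt_iff.1 hw).2).symm, fun w hw => ?_⟩
  rw [← hS w (max_lt_iff.1 hw).2, hFe w (max_lt_iff.1 hw).1]

/-- Every orientation preserving homeomorphism has a lift at infinity, and this lift commutes
with the deck translation. -/
lemma PreservesOrientation.exists_lift {f : ℂ ≃ₜ ℂ} (hf : PreservesOrientation f) :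
    ∃ F : ℂ → ℂ, IsLiftAtInfinity f F ∧
      ∀ᶠ w in coverInfinity, F (w + deckPeriod) = F w + deckPeriod := by
  obtain ⟨F, hF, hFe, hFd⟩ := hf 0
  simp only [zero_add] at hFe
  have hbig : ∀ᶠ w in coverInfinity, 2 * ‖f 0‖ < ‖f (Complex.exp w)‖ :=
    (tendsto_norm_cocompact_atTop.comp
      (f.isClosedEmbedding.tendsto_cocompact.comp tendsto_exp_coverInfinity)).eventually
      (eventually_gt_atTop _)
  obtain ⟨R, hR⟩ := eventually_coverInfinity.1 hbig
  let q : ℂ → ℂ := fun w => f (Complex.exp w) / Complex.exp (F w)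
  have hslit : ∀ w : ℂ, R < w.re → q w ∈ Complex.slitPlane := by
    intro w hw
    have h1 := hR w hw
    have h2 : ‖f 0‖ < ‖Complex.exp (F w)‖ := by
      rw [hFe]
      have := norm_sub_norm_le (f (Complex.exp w)) (f 0)
      linarith
    have h3 : q w = 1 + f 0 / Complex.exp (F w) := by
      have hne := Complex.exp_ne_zero (F w)
      simp only [q]
      field_simp
      rw [hFe]; ring
    rw [h3]
    refine Complex.mem_slitPlane_of_norm_lt_one ?_
    rw [norm_div, div_lt_one (lt_of_le_of_lt (norm_nonneg _) h2)]
    exact h2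
  have hqd : ∀ w, q (w + deckPeriod) = q w := fun w => by
    simp only [q, hFe, exp_add_deckPeriod]
  refine ⟨fun w => F w + Complex.log (q w), ⟨R, ?_, fun w hw => ?_⟩,
    eventually_coverInfinity.2 ⟨R, fun w hw => ?_⟩⟩
  · refine hF.continuousOn.add (ContinuousOn.clog ?_ fun w hw => hslit w hw)
    exact (Continuous.div (by fun_prop) (by fun_prop) fun w => Complex.exp_ne_zero _).continuousOn
  · rw [Complex.exp_add, Complex.exp_log (Complex.slitPlane_ne_zero (hslit w hw))]
    exact mul_div_cancel₀ _ (Complex.exp_ne_zero _)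
  · simp only [hqd, hFd]; ring

lemma IsLiftAtInfinity.deck {f : ℂ ≃ₜ ℂ} (hf : PreservesOrientation f) {F : ℂ → ℂ}
    (hF : IsLiftAtInfinity f F) (k : ℤ) :
    ∀ᶠ w in coverInfinity, F (w + k * deckPeriod) = F w + k * deckPeriod := by
  obtain ⟨G, hG, hGd⟩ := hf.exists_lift
  obtain ⟨m, hm⟩ := hF.unique hG
  obtain ⟨R, hR⟩ := eventually_coverInfinity.1 (hGd.and hm)
  have hre : ∀ (w : ℂ) (k : ℤ), (w + k * deckPeriod).re = w.re := by
    intro w k; simp [deckPeriod]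
  have hR' := add_int_mul_deckPeriod (s := {w : ℂ | R < w.re})
    (fun w hw k => by simpa only [Set.mem_ofPred_eq, hre] using hw) (fun w hw => (hR w hw).1) k
  refine eventually_coverInfinity.2 ⟨R, fun w hw => ?_⟩
  rw [(hR w hw).2, (hR _ (by rw [hre]; exact hw)).2, hR' w hw]
  ring

/-! ### The central extension by lifts at infinity -/

/-- An orientation preserving homeomorphism of the plane together with the germ of a lift of it to
the universal covering of a punctured neighbourhood of infinity. -/
@[ext]
structure LiftedHomeo where
  /-- the homeomorphism of the plane -/
  base : HomeoPlus
  /-- the germ of a lift -/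
  germ : Germ coverInfinity ℂ
  exists_lift : ∃ F : ℂ → ℂ, IsLiftAtInfinity base F ∧ (F : Germ coverInfinity ℂ) = germ

namespace LiftedHomeo

/-- The element given by a homeomorphism and a lift. -/
def mk' (f : HomeoPlus) (F : ℂ → ℂ) (hF : IsLiftAtInfinity f F) : LiftedHomeo :=
  ⟨f, F, F, hF, rfl⟩

lemma mk'_eq_iff {f g : HomeoPlus} {F G : ℂ → ℂ} {hF : IsLiftAtInfinity f F}
    {hG : IsLiftAtInfinity g G} :
    mk' f F hF = mk' g G hG ↔ f = g ∧ F =ᶠ[coverInfinity] G := by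
  rw [LiftedHomeo.ext_iff]
  exact and_congr Iff.rfl Germ.coe_eq

lemma exists_eq_mk' (x : LiftedHomeo) :
    ∃ (f : HomeoPlus) (F : ℂ → ℂ) (hF : IsLiftAtInfinity f F), x = mk' f F hF := by
  obtain ⟨f, φ, F, hF, rfl⟩ := x
  exact ⟨f, F, hF, rfl⟩

lemma germ_tendsto (x : LiftedHomeo) : x.germ.Tendsto coverInfinity := by
  obtain ⟨f, φ, F, hF, rfl⟩ := x
  exact hF.tendsto

/-- Composition of homeomorphisms and of germs of lifts. -/
instance : Mul LiftedHomeo where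
  mul x y := ⟨x.base * y.base, x.germ.compTendsto' y.germ y.germ_tendsto, by
    obtain ⟨f, φ, F, hF, rfl⟩ := x
    obtain ⟨g, ψ, G, hG, rfl⟩ := y
    exact ⟨F ∘ G, hF.comp hG, rfl⟩⟩

lemma mk'_mul {f g : HomeoPlus} {F G : ℂ → ℂ} (hF : IsLiftAtInfinity f F)
    (hG : IsLiftAtInfinity g G) :
    mk' f F hF * mk' g G hG = mk' (f * g) (F ∘ G) (hF.comp hG) := rfl

instance : One LiftedHomeo where
  one := mk' 1 id isLiftAtInfinity_one

lemma one_eq : (1 : LiftedHomeo) = mk' 1 id isLiftAtInfinity_one := rfl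

lemma exists_left_inv (x : LiftedHomeo) : ∃ y : LiftedHomeo, y * x = 1 := by
  obtain ⟨f, F, hF, rfl⟩ := x.exists_eq_mk'
  obtain ⟨H, hH, -⟩ := PreservesOrientation.exists_lift (f⁻¹).2
  have hHF : IsLiftAtInfinity (1 : ℂ ≃ₜ ℂ) (H ∘ F) := by
    have := hH.comp hF
    simpa using this
  obtain ⟨k, hk⟩ := hHF.unique isLiftAtInfinity_one
  refine ⟨mk' f⁻¹ _ (hH.add (-k)), ?_⟩
  rw [mk'_mul, one_eq, mk'_eq_iff]
  refine ⟨inv_mul_cancel f, hk.mono fun w hw => ?_⟩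
  simp only [Function.comp_apply, id] at hw ⊢
  rw [hw]; push_cast; ring

instance : Inv LiftedHomeo where
  inv x := x.exists_left_inv.choose

instance : Group LiftedHomeo :=
  Group.ofLeftAxioms
    (by
      intro x y z
      obtain ⟨f, F, hF, rfl⟩ := x.exists_eq_mk'
      obtain ⟨g, G, hG, rfl⟩ := y.exists_eq_mk'
      obtain ⟨h, H, hH, rfl⟩ := z.exists_eq_mk'
      rfl)
    (by
      intro x
      obtain ⟨f, F, hF, rfl⟩ := x.exists_eq_mk'
      rfl)
    (fun x => x.exists_left_inv.choose_spec)

/-- The projection to the group of homeomorphisms. -/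
def proj : LiftedHomeo →* HomeoPlus where
  toFun := base
  map_one' := rfl
  map_mul' _ _ := rfl

/-- The deck group `ℤ`, where `k` acts as the translation `w ↦ w + 2πik`. -/
def deck : Multiplicative ℤ →* LiftedHomeo where
  toFun k := mk' 1 _ (isLiftAtInfinity_one.add k.toAdd)
  map_one' := by
    rw [one_eq, mk'_eq_iff]
    exact ⟨rfl, Eventually.of_forall fun w => by simp⟩
  map_mul' a b := by
    rw [mk'_mul, mk'_eq_iff]
    refine ⟨(one_mul 1).symm, Eventually.of_forall fun w => ?_⟩
    simp only [Function.comp_apply, id, toAdd_mul]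
    push_cast; ring

end LiftedHomeo

instance : NeBot coverInfinity := by
  refine (atTop_neBot (α := ℝ)).comap_of_surj fun r => ⟨(r : ℂ), by simp⟩

/-- The extension `ℤ → LiftedHomeo → Homeo₊(ℝ²)` whose kernel is the deck group. -/
def eulerExtension : GroupExtension (Multiplicative ℤ) LiftedHomeo HomeoPlus where
  inl := LiftedHomeo.deck
  rightHom := LiftedHomeo.proj
  inl_injective := by
    intro a b hab
    obtain ⟨w, hw⟩ := ((LiftedHomeo.mk'_eq_iff (hF := isLiftAtInfinity_one.add a.toAdd)
      (hG := isLiftAtInfinity_one.add b.toAdd)).1 hab).2.exists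
    have h : ((a.toAdd : ℤ) : ℂ) = b.toAdd := by
      simpa [deckPeriod_ne_zero] using hw
    exact Multiplicative.toAdd.injective (by exact_mod_cast h)
  range_inl_eq_ker_rightHom := by
    ext x
    rw [MonoidHom.mem_range, MonoidHom.mem_ker]
    constructor
    · rintro ⟨k, rfl⟩
      rfl
    · intro hx
      obtain ⟨f, F, hF, rfl⟩ := x.exists_eq_mk'
      obtain rfl : f = 1 := hx
      obtain ⟨k, hk⟩ := hF.unique isLiftAtInfinity_one
      exact ⟨Multiplicative.ofAdd k,
        (LiftedHomeo.mk'_eq_iff (hF := isLiftAtInfinity_one.add k)).2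
          ⟨rfl, hk.mono fun w hw => hw.symm⟩⟩
  rightHom_surjective := fun f => by
    obtain ⟨F, hF, -⟩ := PreservesOrientation.exists_lift f.2
    exact ⟨LiftedHomeo.mk' f F hF, rfl⟩

/-- The deck group is central. -/
lemma eulerExtension_central (k : Multiplicative ℤ) (x : LiftedHomeo) :
    eulerExtension.inl k * x = x * eulerExtension.inl k := by
  obtain ⟨f, F, hF, rfl⟩ := x.exists_eq_mk'
  change LiftedHomeo.mk' 1 _ (isLiftAtInfinity_one.add k.toAdd) * _ =
    _ * LiftedHomeo.mk' 1 _ (isLiftAtInfinity_one.add k.toAdd)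
  rw [LiftedHomeo.mk'_mul, LiftedHomeo.mk'_mul, LiftedHomeo.mk'_eq_iff]
  refine ⟨by rw [one_mul, mul_one], (hF.deck f.2 k.toAdd).mono fun w hw => ?_⟩
  exact hw.symm

/-! ### The cohomology class of a central extension -/

section ExtensionClass

variable {E G : Type*} [Group E] [Group G]

/-- The defect of a set theoretic section of a central extension by `ℤ` from being a
homomorphism: `σ g * σ h = c (g, h) * σ (g * h)`. -/
lemma GroupExtension.exists_defect (S : GroupExtension (Multiplicative ℤ) E G)
    (σ : S.Section) (g h : G) :
    ∃ k : ℤ, σ.toFun g * σ.toFun h = S.inl (Multiplicative.ofAdd k) * σ.toFun (g * h) := by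
  have hmem : σ.toFun g * σ.toFun h * (σ.toFun (g * h))⁻¹ ∈ S.inl.range := by
    rw [S.range_inl_eq_ker_rightHom, MonoidHom.mem_ker]
    simp only [map_mul, map_inv]
    rw [σ.rightInverse_rightHom, σ.rightInverse_rightHom, σ.rightInverse_rightHom, mul_inv_cancel]
  obtain ⟨k, hk⟩ := hmem
  exact ⟨k.toAdd, by rw [ofAdd_toAdd, hk, inv_mul_cancel_right]⟩

/-- The factor set `c` of a section `σ`, with `σ g * σ h = c (g, h) * σ (g * h)`. -/
def GroupExtension.factorSet (S : GroupExtension (Multiplicative ℤ) E G) (σ : S.Section)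
    (p : G × G) : ℤ :=
  (S.exists_defect σ p.1 p.2).choose

lemma GroupExtension.factorSet_spec (S : GroupExtension (Multiplicative ℤ) E G)
    (σ : S.Section) (g h : G) :
    σ.toFun g * σ.toFun h =
      S.inl (Multiplicative.ofAdd (S.factorSet σ (g, h))) * σ.toFun (g * h) :=
  (S.exists_defect σ g h).choose_spec

end ExtensionClass

/-- The trivial coefficient module `ℤ`. -/
abbrev trivialZ (G : Type) [Group G] : Rep ℤ G := Rep.trivial ℤ G ℤ

/-- The factor set of a section of a central extension is a 2-cocycle. -/
lemma GroupExtension.factorSet_mem_cocycles₂ {E G : Type} [Group E] [Group G]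
    (S : GroupExtension (Multiplicative ℤ) E G)
    (hS : ∀ k x, S.inl k * x = x * S.inl k) (σ : S.Section) :
    (S.factorSet σ : G × G → ℤ) ∈ groupCohomology.cocycles₂ (trivialZ G) := by
  rw [groupCohomology.mem_cocycles₂_iff]
  intro g h j
  have key : S.inl (Multiplicative.ofAdd (S.factorSet σ (g * h, j) + S.factorSet σ (g, h))) *
      σ.toFun (g * h * j) =
      S.inl (Multiplicative.ofAdd (S.factorSet σ (h, j) + S.factorSet σ (g, h * j))) *
      σ.toFun (g * h * j) := by
    calc
      _ = S.inl (Multiplicative.ofAdd (S.factorSet σ (g, h))) *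
          (S.inl (Multiplicative.ofAdd (S.factorSet σ (g * h, j))) * σ.toFun (g * h * j)) := by
        rw [add_comm, ofAdd_add, map_mul, mul_assoc]
      _ = S.inl (Multiplicative.ofAdd (S.factorSet σ (g, h))) * σ.toFun (g * h) * σ.toFun j := by
        rw [← S.factorSet_spec, mul_assoc]
      _ = σ.toFun g * (σ.toFun h * σ.toFun j) := by
        rw [← S.factorSet_spec, mul_assoc]
      _ = S.inl (Multiplicative.ofAdd (S.factorSet σ (h, j))) *
          (σ.toFun g * σ.toFun (h * j)) := by
        rw [S.factorSet_spec σ h j, ← mul_assoc, ← hS, mul_assoc]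
      _ = _ := by
        rw [S.factorSet_spec σ g (h * j), ofAdd_add, map_mul, mul_assoc, mul_assoc]
  exact Multiplicative.ofAdd.injective (S.inl_injective (mul_right_cancel key))

/-- The class in `H²(G; ℤ)` of a central extension of `G` by `ℤ`, represented by the factor set of
any section. -/
def GroupExtension.cohomologyClass {E G : Type} [Group E] [Group G]
    (S : GroupExtension (Multiplicative ℤ) E G)
    (hS : ∀ k x, S.inl k * x = x * S.inl k) : groupCohomology.H2 (trivialZ G) :=
  groupCohomology.H2π (trivialZ G)
    ⟨S.factorSet S.surjInvRightHom, S.factorSet_mem_cocycles₂ hS S.surjInvRightHom⟩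

/-- The Euler class `e ∈ H²(Homeo₊(ℝ²); ℤ)`: the class of the central extension by germs at
infinity of lifts. -/
def eulerClass : groupCohomology.H2 (trivialZ HomeoPlus) :=
  eulerExtension.cohomologyClass eulerExtension_central

/-- The pullback `φ^* : H²(H; ℤ) → H²(G; ℤ)` by a homomorphism `φ : G → H`. -/
def pullbackH2 {G H : Type} [Group G] [Group H] (φ : G →* H) :
    groupCohomology.H2 (trivialZ H) →ₗ[ℤ] groupCohomology.H2 (trivialZ G) :=
  (groupCohomology.map φ (𝟙 (trivialZ G) : Rep.res φ (trivialZ H) ⟶ trivialZ G) 2).hom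

/-! ### The evaluation of cohomology on homology -/

section Kronecker

variable {G : Type} [Group G]

/-- The evaluation of a 2-cochain `f` on a 2-chain: `∑ mᵢ (gᵢ, hᵢ) ↦ ∑ mᵢ f (gᵢ, hᵢ)`. -/
def evalChain {G : Type} (f : G × G → ℤ) : (G × G →₀ ℤ) →ₗ[ℤ] ℤ := Finsupp.linearCombination ℤ f

lemma evalChain_single {G : Type} (f : G × G → ℤ) (p : G × G) (m : ℤ) :
    evalChain f (Finsupp.single p m) = m * f p := by
  simp [evalChain]

lemma evalChain_boundary {f : G × G → ℤ} (hf : f ∈ groupCohomology.cocycles₂ (trivialZ G))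
    {z : G × G →₀ ℤ} (hz : z ∈ groupHomology.boundaries₂ (trivialZ G)) : evalChain f z = 0 := by
  obtain ⟨w, rfl⟩ := hz
  have hf' := (groupCohomology.mem_cocycles₂_def (A := trivialZ G) f).1 hf
  have : (evalChain f) ∘ₗ (groupHomology.d₃₂ (trivialZ G)).hom = 0 := by
    refine Finsupp.lhom_ext fun p m => ?_
    have h : f (p.2.1, p.2.2) - f (p.1 * p.2.1, p.2.2) + f (p.1, p.2.1 * p.2.2) -
      f (p.1, p.2.1) = 0 := hf' p.1 p.2.1 p.2.2
    have hd := groupHomology.d₃₂_single (A := trivialZ G) p m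
    rw [LinearMap.comp_apply]
    erw [hd]
    simp only [map_add, map_sub]
    erw [evalChain_single, evalChain_single, evalChain_single, evalChain_single]
    change m * f (p.2.1, p.2.2) - m * f (p.1 * p.2.1, p.2.2) + m * f (p.1, p.2.1 * p.2.2) -
      m * f (p.1, p.2.1) = (0 : ℤ)
    linear_combination (m : ℤ) * h
  exact LinearMap.congr_fun this w

lemma evalChain_coboundary {f : G × G → ℤ}
    (hf : f ∈ groupCohomology.coboundaries₂ (trivialZ G)) {z : G × G →₀ ℤ}
    (hz : z ∈ groupHomology.cycles₂ (trivialZ G)) : evalChain f z = 0 := by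
  obtain ⟨x, rfl⟩ := hf
  have : evalChain ((groupCohomology.d₁₂ (trivialZ G)).hom x) =
      Finsupp.linearCombination ℤ x ∘ₗ (groupHomology.d₂₁ (trivialZ G)).hom := by
    refine Finsupp.lhom_ext fun p m => ?_
    have hd := groupHomology.d₂₁_single (A := trivialZ G) p m
    rw [LinearMap.comp_apply]
    erw [hd, evalChain_single]
    simp only [map_add, map_sub]
    erw [Finsupp.linearCombination_single, Finsupp.linearCombination_single,
      Finsupp.linearCombination_single]
    change m * (x p.2 - x (p.1 * p.2) + x p.1 : ℤ) =
      m * (x p.2 : ℤ) - m * (x (p.1 * p.2) : ℤ) + m * (x p.1 : ℤ)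
    ring
  rw [this, LinearMap.comp_apply, show (groupHomology.d₂₁ (trivialZ G)).hom z = 0 from hz, map_zero]

lemma H2π_homology_surjective :
    Function.Surjective (groupHomology.H2π (trivialZ G)).hom :=
  (ModuleCat.epi_iff_surjective (groupHomology.H2π (trivialZ G))).1 inferInstance

lemma H2π_cohomology_surjective :
    Function.Surjective (groupCohomology.H2π (trivialZ G)).hom :=
  (ModuleCat.epi_iff_surjective (groupCohomology.H2π (trivialZ G))).1 inferInstance

/-- The linear map induced on the target of a surjective linear map `π` by a linear map that
vanishes on the kernel of `π`. -/
def descend {R M N P : Type*} [Ring R] [AddCommGroup M] [AddCommGroup N] [AddCommGroup P]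
    [Module R M] [Module R N] [Module R P] (π : M →ₗ[R] N) (hπ : Function.Surjective π)
    (φ : M →ₗ[R] P) (h : LinearMap.ker π ≤ LinearMap.ker φ) : N →ₗ[R] P :=
  (LinearMap.ker π).liftQ φ h ∘ₗ (π.quotKerEquivOfSurjective hπ).symm.toLinearMap

lemma descend_apply {R M N P : Type*} [Ring R] [AddCommGroup M] [AddCommGroup N] [AddCommGroup P]
    [Module R M] [Module R N] [Module R P] (π : M →ₗ[R] N) (hπ : Function.Surjective π)
    (φ : M →ₗ[R] P) (h : LinearMap.ker π ≤ LinearMap.ker φ) (x : M) :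
    descend π hπ φ h (π x) = φ x := by
  have : (π.quotKerEquivOfSurjective hπ).symm (π x) = (LinearMap.ker π).mkQ x := by
    rw [LinearEquiv.symm_apply_eq]
    rfl
  simp [descend, this]

/-- The evaluation of a 2-cocycle on `H₂(G; ℤ)`. -/
def evalCocycle (f : groupCohomology.cocycles₂ (trivialZ G)) :
    groupHomology.H2 (trivialZ G) →ₗ[ℤ] ℤ :=
  descend (groupHomology.H2π (trivialZ G)).hom H2π_homology_surjective
    (evalChain f.1 ∘ₗ (groupHomology.cycles₂ (trivialZ G)).subtype)
    (fun z hz => evalChain_boundary f.2 ((groupHomology.H2π_eq_zero_iff z).1 hz))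

lemma evalCocycle_H2π (f : groupCohomology.cocycles₂ (trivialZ G))
    (z : groupHomology.cycles₂ (trivialZ G)) :
    evalCocycle f ((groupHomology.H2π (trivialZ G)).hom z) = evalChain f.1 z.1 :=
  descend_apply _ H2π_homology_surjective _ _ z

lemma evalChain_add {G : Type} (f f' : G × G → ℤ) : evalChain (f + f') = evalChain f + evalChain f' :=
  Finsupp.lhom_ext fun p m => by simp [evalChain_single, mul_add]

lemma evalChain_smul {G : Type} (k : ℤ) (f : G × G → ℤ) : evalChain (k • f) = k • evalChain f :=
  Finsupp.lhom_ext fun p m => by simp [evalChain_single]; ring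

/-- The evaluation of 2-cocycles on `H₂(G; ℤ)`, as a linear map. -/
def evalCocycles :
    groupCohomology.cocycles₂ (trivialZ G) →ₗ[ℤ] groupHomology.H2 (trivialZ G) →ₗ[ℤ] ℤ where
  toFun := evalCocycle
  map_add' f f' := LinearMap.ext fun y => by
    obtain ⟨z, rfl⟩ := H2π_homology_surjective y
    rw [LinearMap.add_apply, evalCocycle_H2π, evalCocycle_H2π, evalCocycle_H2π]
    exact LinearMap.congr_fun (evalChain_add f.1 f'.1) z.1
  map_smul' k f := LinearMap.ext fun y => by
    obtain ⟨z, rfl⟩ := H2π_homology_surjective y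
    rw [LinearMap.smul_apply, evalCocycle_H2π, evalCocycle_H2π]
    exact LinearMap.congr_fun (evalChain_smul k f.1) z.1

lemma ker_H2π_le_ker_evalCocycles :
    LinearMap.ker (groupCohomology.H2π (trivialZ G)).hom ≤ LinearMap.ker (evalCocycles (G := G)) :=
  fun f hf => LinearMap.ext fun y => by
    obtain ⟨z, rfl⟩ := H2π_homology_surjective y
    exact (evalCocycle_H2π f z).trans
      (evalChain_coboundary ((groupCohomology.H2π_eq_zero_iff f).1 hf) z.2)

/-- The Kronecker pairing `H²(G; ℤ) → Hom(H₂(G; ℤ), ℤ)`. -/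
def kronecker : groupCohomology.H2 (trivialZ G) →ₗ[ℤ] groupHomology.H2 (trivialZ G) →ₗ[ℤ] ℤ :=
  descend (groupCohomology.H2π (trivialZ G)).hom H2π_cohomology_surjective evalCocycles
    ker_H2π_le_ker_evalCocycles

/-- The Kronecker pairing is the evaluation of cocycles on cycles. -/
lemma kronecker_H2π (f : groupCohomology.cocycles₂ (trivialZ G))
    (z : groupHomology.cycles₂ (trivialZ G)) :
    kronecker ((groupCohomology.H2π (trivialZ G)).hom f)
      ((groupHomology.H2π (trivialZ G)).hom z) = evalChain f.1 z.1 := by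
  have h : kronecker ((groupCohomology.H2π (trivialZ G)).hom f) = evalCocycle f :=
    descend_apply _ H2π_cohomology_surjective evalCocycles ker_H2π_le_ker_evalCocycles f
  rw [h]
  exact evalCocycle_H2π f z

end Kronecker

/-- The Euler number `ρ^*e (c)` of an action `ρ` on the plane, with respect to a class `c` in
`H₂(G; ℤ)`. -/
def eulerNumber {G : Type} [Group G] (ρ : G →* HomeoPlus)
    (c : groupHomology.H2 (trivialZ G)) : ℤ :=
  kronecker (pullbackH2 ρ eulerClass) c

/-! ### Closed orientable surfaces -/

/-- The point with parameter `t ∈ [0, 1]` on the `k`-th of `m` equal consecutive edges of the unit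
circle, the boundary of the unit disk. -/
def edgePoint (m k : ℕ) (t : unitInterval) : Metric.closedBall (0 : ℂ) 1 :=
  ⟨Complex.exp ((2 * Real.pi * ((k + t) / m) : ℝ) * Complex.I), by
    rw [mem_closedBall_zero_iff, Complex.norm_exp_ofReal_mul_I]⟩

/-- The edge identifications of a `4g`-gon with boundary word
`a₁ b₁ a₁⁻¹ b₁⁻¹ ⋯ a_g b_g a_g⁻¹ b_g⁻¹`. -/
inductive EdgeGluing (g : ℕ) : Metric.closedBall (0 : ℂ) 1 → Metric.closedBall (0 : ℂ) 1 → Prop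
  | a (j : ℕ) (hj : j < g) (t : unitInterval) :
      EdgeGluing g (edgePoint (4 * g) (4 * j) t) (edgePoint (4 * g) (4 * j + 2) (unitInterval.symm t))
  | b (j : ℕ) (hj : j < g) (t : unitInterval) :
      EdgeGluing g (edgePoint (4 * g) (4 * j + 1) t)
        (edgePoint (4 * g) (4 * j + 3) (unitInterval.symm t))

/-- The closed orientable surface `S_g` of genus `g ≥ 1`: the quotient of the `4g`-gon by the edge
identifications. -/
def ClosedSurface (g : ℕ) : Type := Quot (EdgeGluing g)

instance (g : ℕ) : TopologicalSpace (ClosedSurface g) :=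
  inferInstanceAs (TopologicalSpace (Quot (EdgeGluing g)))

/-- The fundamental group `π₁(S_g, x)`. -/
abbrev surfaceGroup (g : ℕ) (x : ClosedSurface g) : Type := FundamentalGroup (ClosedSurface g) x

/-- A fundamental class of `G = π₁(S_g)`: a generator of `H₂(G; ℤ)`. As `H₂(G; ℤ)` is infinite
cyclic for `g ≥ 1`, there are two, `[S_g]` for the two orientations of `S_g`. -/
def IsFundamentalClass {g : ℕ} {x : ClosedSurface g}
    (c : groupHomology.H2 (trivialZ (surfaceGroup g x))) : Prop :=
  Submodule.span ℤ {c} = ⊤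

end

/-! The plane carries an action of `ℤ²` whose Euler class is already nontrivial. The generators are
the dilation `z ↦ e^{2π} z` and the map that rotates the circle of radius `r` by the angle `log r`.
Dilating adds `2π` to `log r`, so the rotation angle changes by a full turn and the two maps commute
(`spiral_spiral`). Their lifts at infinity do not: the full turn survives as a deck translation.
With the explicit lifts the factor set is the bilinear cocycle `((s, t), (s', t')) ↦ t s'`
(`spiralSection_mul`). Hence an action that factors through `(φ, ψ) : G → ℤ²` has as Euler class the
cup product of `ψ` and `φ` (`eulerNumber_H2π`, `eulerNumber_spiralAction`).

On the surface group, the boundary word of the polygon, a product of commutators that bounds a disk,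
gives an explicit 2-cycle on which such cup products are given by the intersection form
(`exists_commutatorCycle`, `exists_surfaceCycle`). Two maps from the surface to the circle detect
the first pair of edges (`surfaceToCircle`, `edgeHom_edgeHolonomy_a`, `edgeHom_edgeHolonomy_b`).
Replacing one of the resulting homomorphisms by a power realizes every integer on the class `y` of
this cycle (`exists_eulerNumber_eq`).

Neither the structure of `H₂` nor the fact that `y` generates it has to be established. If `c` is a
generator then `y = k c`, the Euler number `1` on `y` forces `k ≠ 0`, and an action with Euler
number `k n` on `y` has Euler number `n` on `c`. -/

noncomputable section

/-! ### Isotopies of the plane preserve orientation -/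

/-- A homeomorphism of the plane that is isotopic to the identity preserves orientation. -/
lemma preservesOrientation_of_isotopy {f : ℂ ≃ₜ ℂ} (H : ℝ → ℂ → ℂ)
    (hH : Continuous fun q : ℝ × ℂ => H q.1 q.2) (hinj : ∀ τ, Function.Injective (H τ))
    (h₀ : ∀ z, H 0 z = z) (h₁ : ∀ z, H 1 z = f z) : PreservesOrientation f := by
  intro p
  have hne : ∀ q : ℝ × ℂ, H q.1 (p + Complex.exp q.2) - H q.1 p ≠ 0 := fun q h => by
    have := hinj _ (sub_eq_zero.1 h)
    simp at this
  have hcont : Continuous fun q : ℝ × ℂ => H q.1 (p + Complex.exp q.2) - H q.1 p :=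
    (hH.comp (f := fun q : ℝ × ℂ => (q.1, p + Complex.exp q.2)) (by fun_prop)).sub
      (hH.comp (f := fun q : ℝ × ℂ => (q.1, p)) (by fun_prop))
  -- Lifting the whole isotopy over the simply connected space `ℝ × ℂ` connects the wanted lift, at
  -- time `1`, with the identity, at time `0`.
  obtain ⟨K, ⟨hK0, hKe⟩, -⟩ := Complex.isCoveringMapOn_exp.existsUnique_continuousMap_lifts
    (A := ℝ × ℂ) ⟨_, hcont⟩ (a₀ := (0, 0)) (e₀ := 0) (by simp [h₀]) (fun q => hne q)
  have hKe' : ∀ τ w, Complex.exp (K (τ, w)) = H τ (p + Complex.exp w) - H τ p :=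
    fun τ w => congrFun hKe (τ, w)
  have hK : ∀ w, K (0, w) = w := by
    obtain ⟨k, hk⟩ := exists_int_of_exp_eq (F := fun w => K (0, w)) (G := id)
      isPreconnected_univ (by fun_prop) continuousOn_id (fun w _ => by simp [hKe', h₀])
    have hk0 := hk 0 trivial
    rw [hK0] at hk0
    intro w
    rw [hk w trivial]
    simpa using hk0.symm
  refine ⟨fun w => K (1, w), by fun_prop, fun w => by rw [hKe', h₁, h₁], fun w => ?_⟩
  -- For fixed `w` the shift under the deck translation is an integer that is constant in time, and
  -- at time `0` it is one period. Time enters as `u.re` because the comparison is available for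
  -- functions on `ℂ`.
  obtain ⟨k, hk⟩ := exists_int_of_exp_eq (F := fun u => K (u.re, w + deckPeriod))
    (G := fun u => K (u.re, w)) isPreconnected_univ (by fun_prop) (by fun_prop)
    (fun u _ => by rw [hKe', hKe', exp_add_deckPeriod])
  have h0 := hk 0 trivial
  have h1 := hk 1 trivial
  simp only [Complex.zero_re, Complex.one_re, hK] at h0 h1
  change K (1, w + deckPeriod) = K (1, w) + deckPeriod
  rw [h1, ← add_left_cancel h0]

/-! ### Spiral homeomorphisms -/

/-- The map that multiplies radii by `e ^ (2πs)` and rotates the circle of radius `r` by the angle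
`t log r`. -/
def spiral (s t : ℝ) (z : ℂ) : ℂ :=
  z * Complex.exp ((2 * Real.pi * s : ℝ) + (t * Real.log ‖z‖ : ℝ) * Complex.I)

lemma norm_spiral (s t : ℝ) (z : ℂ) : ‖spiral s t z‖ = ‖z‖ * Real.exp (2 * Real.pi * s) := by
  simp [spiral, Complex.norm_exp]

lemma spiral_zero (z : ℂ) : spiral 0 0 z = z := by simp [spiral]

/-- The norm of the image determines the norm of the point, and the multiplier depends on that norm
alone. -/
lemma spiral_injective (s t : ℝ) : Function.Injective (spiral s t) := by
  intro z w h
  have hn : ‖z‖ = ‖w‖ := by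
    have := congrArg norm h
    rw [norm_spiral, norm_spiral] at this
    exact mul_right_cancel₀ (Real.exp_ne_zero _) this
  simp only [spiral, hn] at h
  exact mul_right_cancel₀ (Complex.exp_ne_zero _) h

lemma continuous_spiral : Continuous fun q : (ℝ × ℝ) × ℂ => spiral q.1.1 q.1.2 q.2 := by
  rw [continuous_iff_continuousAt]
  rintro ⟨⟨s, t⟩, z⟩
  -- At the origin the rotation angle has no limit, but the norm of the image tends to `0`.
  rcases eq_or_ne z 0 with rfl | hz
  · have h : Tendsto (fun q : (ℝ × ℝ) × ℂ => ‖q.2‖ * Real.exp (2 * Real.pi * q.1.1))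
        (𝓝 ((s, t), 0)) (𝓝 0) := by
      have : Continuous fun q : (ℝ × ℝ) × ℂ => ‖q.2‖ * Real.exp (2 * Real.pi * q.1.1) := by
        fun_prop
      simpa using this.tendsto ((s, t), 0)
    rw [ContinuousAt, show spiral (s, t).1 (s, t).2 0 = 0 by simp [spiral]]
    exact squeeze_zero_norm (fun q => (norm_spiral _ _ _).le) h
  · have hlog : ContinuousAt (fun q : (ℝ × ℝ) × ℂ => Real.log ‖q.2‖) ((s, t), z) :=
      ContinuousAt.log (by fun_prop) (norm_ne_zero_iff.2 hz)
    unfold spiral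
    fun_prop

lemma continuous_spiral_left (s t : ℝ) : Continuous (spiral s t) :=
  continuous_spiral.comp (f := fun z : ℂ => ((s, t), z)) (by fun_prop)

/-- Composition of spiral maps. -/
lemma spiral_spiral (s t s' t' : ℤ) (z : ℂ) :
    spiral s t (spiral s' t' z) = spiral (s + s' : ℤ) (t + t' : ℤ) z := by
  rcases eq_or_ne z 0 with rfl | hz
  · simp [spiral]
  have hlog : Real.log ‖spiral s' t' z‖ = Real.log ‖z‖ + 2 * Real.pi * s' := by
    rw [norm_spiral, Real.log_mul (norm_ne_zero_iff.2 hz) (Real.exp_ne_zero _), Real.log_exp]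
  -- The outer map sees the radius enlarged by the inner one and rotates by an extra angle `2π t
  -- s'`. Integrality makes this a multiple of a full turn, which the integer `-(t * s')` removes.
  rw [spiral, hlog, spiral, spiral, mul_assoc, ← Complex.exp_add,
    ← exp_add_int_mul_deckPeriod (_ + _) (-(t * s'))]
  congr 2
  push_cast [deckPeriod]
  ring

/-- The spiral maps with integral parameters as homeomorphisms. -/
def spiralHomeo (s t : ℤ) : ℂ ≃ₜ ℂ where
  toFun := spiral s t
  invFun := spiral (-s : ℤ) (-t : ℤ)
  left_inv z := by rw [spiral_spiral]; simp [spiral_zero]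
  right_inv z := by rw [spiral_spiral]; simp [spiral_zero]
  continuous_toFun := continuous_spiral_left _ _
  continuous_invFun := continuous_spiral_left _ _

lemma spiralHomeo_apply (s t : ℤ) (z : ℂ) : spiralHomeo s t z = spiral s t z := rfl

/-- The isotopy scales both parameters. At non-integral parameters the spirals no longer compose
additively, but they remain injective and jointly continuous, which suffices. -/
lemma preservesOrientation_spiralHomeo (s t : ℤ) : PreservesOrientation (spiralHomeo s t) :=
  preservesOrientation_of_isotopy (fun τ => spiral (τ * s) (τ * t))
    (continuous_spiral.comp (f := fun q : ℝ × ℂ => ((q.1 * s, q.1 * t), q.2)) (by fun_prop))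
    (fun _ => spiral_injective _ _) (fun z => by simp [spiral_zero])
    (fun z => by rw [one_mul, one_mul, spiralHomeo_apply])

/-- The action of `ℤ²` on the plane by spiral homeomorphisms. -/
def spiralAction : Multiplicative ℤ × Multiplicative ℤ →* HomeoPlus where
  toFun v := ⟨spiralHomeo v.1.toAdd v.2.toAdd, preservesOrientation_spiralHomeo _ _⟩
  map_one' := Subtype.ext (Homeomorph.ext fun z => by simp [spiralHomeo_apply, spiral_zero])
  map_mul' v w := Subtype.ext (Homeomorph.ext fun z => by
    simp [spiralHomeo_apply, spiral_spiral])

/-- A lift of a spiral homeomorphism at infinity. -/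
def spiralLift (s t : ℤ) (w : ℂ) : ℂ := w + (2 * Real.pi * s : ℝ) + (t * w.re : ℝ) * Complex.I

lemma isLiftAtInfinity_spiralLift (s t : ℤ) :
    IsLiftAtInfinity (spiralHomeo s t) (spiralLift s t) := by
  refine ⟨0, Continuous.continuousOn (by unfold spiralLift; fun_prop), fun w _ => ?_⟩
  rw [spiralHomeo_apply, spiral, Complex.norm_exp, Real.log_exp, spiralLift, ← Complex.exp_add, add_assoc]

/-- The lift of the action of `v`. -/
def spiralSection (v : Multiplicative ℤ × Multiplicative ℤ) : LiftedHomeo :=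
  LiftedHomeo.mk' (spiralAction v) _ (isLiftAtInfinity_spiralLift v.1.toAdd v.2.toAdd)

/-- The inner lift raises `re u` by `2π w.1`, and the outer one multiplies this by `v.2` in the
imaginary direction. This extra `2πi` multiple is the whole source of the Euler class. -/
lemma spiralSection_mul (v w : Multiplicative ℤ × Multiplicative ℤ) :
    spiralSection v * spiralSection w =
      LiftedHomeo.deck (Multiplicative.ofAdd (v.2.toAdd * w.1.toAdd)) * spiralSection (v * w) := by
  have hl (v : Multiplicative ℤ × Multiplicative ℤ) :
      IsLiftAtInfinity (spiralAction v) (spiralLift v.1.toAdd v.2.toAdd) :=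
    isLiftAtInfinity_spiralLift _ _
  refine (LiftedHomeo.mk'_eq_iff (f := spiralAction v * spiralAction w)
    (g := 1 * spiralAction (v * w)) (hF := (hl v).comp (hl w))
    (hG := (isLiftAtInfinity_one.add (v.2.toAdd * w.1.toAdd)).comp (hl (v * w)))).2
    ⟨by rw [one_mul, map_mul], Eventually.of_forall fun u => ?_⟩
  simp [spiralLift, deckPeriod]
  ring

/-! ### Computing Euler numbers -/

/-- The pairing of the pullback of a cocycle with a cycle. -/
lemma kronecker_pullbackH2 {G H : Type} [Group G] [Group H] (ρ : G →* H)
    (f : groupCohomology.cocycles₂ (trivialZ H)) (z : groupHomology.cycles₂ (trivialZ G)) :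
    kronecker (pullbackH2 ρ (groupCohomology.H2π (trivialZ H) f))
      ((groupHomology.H2π (trivialZ G)).hom z) =
      evalChain (fun p : G × G => f.1 (ρ p.1, ρ p.2)) z.1 := by
  have h := LinearMap.congr_fun (congrArg ModuleCat.Hom.hom (groupCohomology.H2π_comp_map ρ
    (𝟙 (trivialZ G) : Rep.res ρ (trivialZ H) ⟶ trivialZ G))) f
  rw [ModuleCat.hom_comp, ModuleCat.hom_comp, LinearMap.comp_apply, LinearMap.comp_apply] at h
  have h' : pullbackH2 ρ (groupCohomology.H2π (trivialZ H) f) = _ := h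
  rw [h', kronecker_H2π]
  rfl

/-- The Euler number of an action on a cycle can be computed from any lift of the action to
`LiftedHomeo`. -/
lemma eulerNumber_H2π {G : Type} [Group G] (ρ : G →* HomeoPlus) (s : G → LiftedHomeo)
    (hs : ∀ g, (s g).base = ρ g) (F : G × G → ℤ)
    (hF : ∀ g h, s g * s h = LiftedHomeo.deck (Multiplicative.ofAdd (F (g, h))) * s (g * h))
    (z : groupHomology.cycles₂ (trivialZ G)) :
    eulerNumber ρ ((groupHomology.H2π (trivialZ G)).hom z) = evalChain F z.1 := by
  let σ := eulerExtension.surjInvRightHom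
  -- The given lifts and the chosen section differ by a 1-cochain `u`. Centrality then makes the two
  -- factor sets differ by its coboundary, which cycles do not see.
  have hu : ∀ g, ∃ u : ℤ, LiftedHomeo.deck (Multiplicative.ofAdd u) * s g = σ.toFun (ρ g) := by
    intro g
    have hmem : σ.toFun (ρ g) * (s g)⁻¹ ∈ eulerExtension.inl.range := by
      rw [eulerExtension.range_inl_eq_ker_rightHom, MonoidHom.mem_ker, map_mul, map_inv,
        σ.rightInverse_rightHom, mul_inv_eq_one]
      exact (hs g).symm
    obtain ⟨k, hk⟩ := hmem
    exact ⟨k.toAdd, mul_inv_eq_iff_eq_mul.1 hk.symm ▸ rfl⟩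
  choose u hu using hu
  have hfac : (fun p : G × G => eulerExtension.factorSet σ (ρ p.1, ρ p.2)) =
      F + ((groupCohomology.d₁₂ (trivialZ G)).hom u : G × G → ℤ) := by
    funext ⟨g, h⟩
    have h1 := eulerExtension.factorSet_spec σ (ρ g) (ρ h)
    rw [← map_mul, ← hu g, ← hu h, ← hu (g * h)] at h1
    have h2 : ∀ (k : ℤ) x, x * LiftedHomeo.deck (Multiplicative.ofAdd k) =
      LiftedHomeo.deck (Multiplicative.ofAdd k) * x := fun k x => (eulerExtension_central _ x).symm
    rw [mul_assoc, ← mul_assoc (s g), h2, mul_assoc _ (s g), hF, ← mul_assoc, ← mul_assoc,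
      ← mul_assoc] at h1
    have h3 := mul_right_cancel h1
    change _ = eulerExtension.inl _ * eulerExtension.inl _ at h3
    change eulerExtension.inl _ * eulerExtension.inl _ * eulerExtension.inl _ = _ at h3
    rw [← MonoidHom.map_mul, ← MonoidHom.map_mul, ← MonoidHom.map_mul, ← ofAdd_add, ← ofAdd_add,
      ← ofAdd_add] at h3
    have h4 := Multiplicative.ofAdd.injective (eulerExtension.inl_injective h3)
    change eulerExtension.factorSet σ (ρ g, ρ h) = F (g, h) + (u h - u (g * h) + u g)
    linarith
  rw [eulerNumber, eulerClass, GroupExtension.cohomologyClass, kronecker_pullbackH2]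
  change evalChain (fun p : G × G => eulerExtension.factorSet σ (ρ p.1, ρ p.2)) z.1 = _
  rw [hfac, evalChain_add, LinearMap.add_apply, evalChain_coboundary ⟨u, rfl⟩ z.2, add_zero]

/-- The Euler number of an action of a group through the spiral action of `ℤ²`. -/
lemma eulerNumber_spiralAction {G : Type} [Group G] (φ ψ : G →* Multiplicative ℤ)
    (z : groupHomology.cycles₂ (trivialZ G)) :
    eulerNumber (spiralAction.comp (φ.prod ψ)) ((groupHomology.H2π (trivialZ G)).hom z) =
      evalChain (fun p => (ψ p.1).toAdd * (φ p.2).toAdd) z.1 :=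
  eulerNumber_H2π _ (fun g => spiralSection (φ g, ψ g)) (fun _ => rfl) _
    (fun g h => by rw [spiralSection_mul, Prod.mk_mul_mk, MonoidHom.map_mul, MonoidHom.map_mul]) z

/-! ### The 2-cycle of a product of commutators -/

section CommutatorCycle

variable {G : Type} [Group G]

/-- The differential of the inhomogeneous chain complex with trivial coefficients. -/
lemma d₂₁_single_one (g h : G) :
    (groupHomology.d₂₁ (trivialZ G)).hom (Finsupp.single (g, h) (1 : ℤ) : G × G →₀ ℤ) =
      (Finsupp.single h 1 - Finsupp.single (g * h) 1 + Finsupp.single g 1 : G →₀ ℤ) :=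
  groupHomology.d₂₁_single (A := trivialZ G) (g, h) (1 : ℤ)

/-- A chain with boundary `- [a b a⁻¹ b⁻¹]`. -/
def commutatorChain (a b : G) : G × G →₀ ℤ :=
  Finsupp.single (a, b) 1 - Finsupp.single (b, a) 1 -
    Finsupp.single (a * b * a⁻¹ * b⁻¹, b * a) 1

lemma d₂₁_commutatorChain (a b : G) :
    (groupHomology.d₂₁ (trivialZ G)).hom (commutatorChain a b) =
      (-Finsupp.single (a * b * a⁻¹ * b⁻¹) 1 : G →₀ ℤ) := by
  have h : a * b * a⁻¹ * b⁻¹ * (b * a) = a * b := by group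
  change (groupHomology.d₂₁ (trivialZ G)).hom ((Finsupp.single (a, b) 1 : G × G →₀ ℤ) -
    (Finsupp.single (b, a) 1 : G × G →₀ ℤ) -
    (Finsupp.single (a * b * a⁻¹ * b⁻¹, b * a) 1 : G × G →₀ ℤ)) = _
  erw [map_sub, map_sub]
  rw [d₂₁_single_one, d₂₁_single_one, d₂₁_single_one, h]
  change (_ : G →₀ ℤ) = _
  abel

/-- The third simplex of the chain contributes nothing, since `ψ` kills the commutator in its first
slot. -/
lemma evalChain_commutatorChain (φ ψ : G →* Multiplicative ℤ) (a b : G) :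
    evalChain (fun p => (ψ p.1).toAdd * (φ p.2).toAdd) (commutatorChain a b) =
      (ψ a).toAdd * (φ b).toAdd - (ψ b).toAdd * (φ a).toAdd := by
  simp [commutatorChain, evalChain_single]

/-- If `P` is the sequence of partial products of the commutators of `a j` and `b j`, and the
product of the first `n` is trivial, then there is a 2-cycle on which a cup product of homomorphisms
to `ℤ` takes the value that the intersection form prescribes. -/
lemma exists_commutatorCycle (a b P : ℕ → G) {n : ℕ} (h0 : P 0 = 1)
    (hP : ∀ j < n, P (j + 1) = P j * (a j * b j * (a j)⁻¹ * (b j)⁻¹)) (hn : P n = 1) :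
    ∃ z : groupHomology.cycles₂ (trivialZ G), ∀ φ ψ : G →* Multiplicative ℤ,
      evalChain (fun p => (ψ p.1).toAdd * (φ p.2).toAdd) z.1 = ∑ j ∈ Finset.range n,
        ((ψ (a j)).toAdd * (φ (b j)).toAdd - (ψ (b j)).toAdd * (φ (a j)).toAdd) := by
  -- The commutator chains have boundary minus the commutators. The simplices `(P j, [a j, b j])`
  -- trade these for differences of partial products, so the boundary telescopes to `[1] - [P k]`.
  let c : ℕ → (G × G →₀ ℤ) := fun k => ∑ j ∈ Finset.range k,
    (commutatorChain (a j) (b j) + Finsupp.single (P j, a j * b j * (a j)⁻¹ * (b j)⁻¹) 1)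
  have hc : ∀ k, c (k + 1) = c k + (commutatorChain (a k) (b k) +
      Finsupp.single (P k, a k * b k * (a k)⁻¹ * (b k)⁻¹) 1) := fun k =>
    Finset.sum_range_succ _ k
  have hd : ∀ k ≤ n, (groupHomology.d₂₁ (trivialZ G)).hom (c k) =
      (Finsupp.single 1 1 - Finsupp.single (P k) 1 : G →₀ ℤ) := by
    intro k hk
    induction k with
    | zero =>
      rw [h0, sub_self]
      exact map_zero _
    | succ k ih =>
      rw [hc]
      erw [map_add, map_add]
      rw [ih (by omega), d₂₁_commutatorChain, d₂₁_single_one, ← hP k hk]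
      change (_ : G →₀ ℤ) = _
      abel
  refine ⟨⟨c n, ?_⟩, fun φ ψ => ?_⟩
  · change (groupHomology.d₂₁ (trivialZ G)).hom (c n) = 0
    rw [hd n le_rfl, hn]
    exact sub_self (_ : G →₀ ℤ)
  · simp only [c, map_sum, map_add, evalChain_commutatorChain, evalChain_single]
    refine Finset.sum_congr rfl fun j _ => ?_
    -- The telescoping simplices have a commutator in the second slot, where `φ` is evaluated.
    have hφ : φ (a j * b j * (a j)⁻¹ * (b j)⁻¹) = 1 := by
      simp only [map_mul, map_inv]
      rw [mul_comm (φ (a j)) (φ (b j))]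
      group
    rw [hφ]
    simp

end CommutatorCycle

/-! ### Winding numbers -/

section Winding

open unitInterval

lemma isCoveringMap_addCircle : IsCoveringMap ((↑) : ℝ → AddCircle (1 : ℝ)) :=
  AddCircle.isCoveringMap_coe 1

/-- The displacement of a lift to `ℝ` of a path in the circle. -/
def circleDisplacement {y z : AddCircle (1 : ℝ)} (γ : Path y z) : ℝ :=
  isCoveringMap_addCircle.liftPath γ y.out
    (γ.source.trans (Quotient.out_eq y).symm) 1 - y.out

/-- Two lifts differ by a constant translation, so any lift may be used in place of the one starting
at `y.out`. -/
lemma circleDisplacement_eq {y z : AddCircle (1 : ℝ)} (γ : Path y z) (Γ : C(I, ℝ))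
    (h : ∀ t, (Γ t : AddCircle (1 : ℝ)) = γ t) : circleDisplacement γ = Γ 1 - Γ 0 := by
  have hy : ((y.out : ℝ) : AddCircle (1 : ℝ)) = y := Quotient.out_eq y
  have hlift : (⟨fun t => Γ t - Γ 0 + y.out, by fun_prop⟩ : C(I, ℝ)) =
      isCoveringMap_addCircle.liftPath γ y.out
        (γ.source.trans hy.symm) := by
    rw [isCoveringMap_addCircle.eq_liftPath_iff']
    refine ⟨funext fun t => ?_, by simp⟩
    change ((Γ t - Γ 0 + y.out : ℝ) : AddCircle (1 : ℝ)) = γ t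
    rw [AddCircle.coe_add, AddCircle.coe_sub, h, h, hy, γ.source, sub_add_cancel]
  rw [circleDisplacement, ← hlift]
  simp

lemma exists_lift_path {y z : AddCircle (1 : ℝ)} (γ : Path y z) (e : ℝ)
    (he : (e : AddCircle (1 : ℝ)) = y) :
    ∃ Γ : C(I, ℝ), Γ 0 = e ∧ ∀ t, (Γ t : AddCircle (1 : ℝ)) = γ t := by
  have h0 : (γ : C(I, AddCircle (1 : ℝ))) 0 = e := γ.source.trans he.symm
  exact ⟨_, isCoveringMap_addCircle.liftPath_zero γ e h0,
    congrFun (isCoveringMap_addCircle.liftPath_lifts γ e h0)⟩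

lemma circleDisplacement_congr {y z : AddCircle (1 : ℝ)} {γ γ' : Path y z}
    (h : γ.Homotopic γ') : circleDisplacement γ = circleDisplacement γ' :=
  congrArg (· - y.out)
    (isCoveringMap_addCircle.liftPath_apply_one_eq_of_homotopicRel h _ _ _)

lemma circleDisplacement_trans {x y z : AddCircle (1 : ℝ)} (γ : Path x y) (γ' : Path y z) :
    circleDisplacement (γ.trans γ') = circleDisplacement γ + circleDisplacement γ' := by
  obtain ⟨Γ, -, hΓ⟩ := exists_lift_path γ x.out (Quotient.out_eq x)
  obtain ⟨Γ', h0, hΓ'⟩ := exists_lift_path γ' (Γ 1) (by rw [hΓ, γ.target])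
  let p : Path (Γ 0) (Γ 1) := ⟨Γ, rfl, rfl⟩
  let q : Path (Γ 1) (Γ' 1) := ⟨Γ', h0, rfl⟩
  rw [circleDisplacement_eq γ Γ hΓ, circleDisplacement_eq γ' Γ' hΓ',
    circleDisplacement_eq (γ.trans γ') (p.trans q : C(I, ℝ)), h0]
  · simp
  · intro t
    change ((p.trans q t : ℝ) : AddCircle (1 : ℝ)) = _
    rw [Path.trans_apply, Path.trans_apply]
    split_ifs
    exacts [hΓ _, hΓ' _]

lemma exists_int_circleDisplacement {y : AddCircle (1 : ℝ)} (γ : Path y y) :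
    ∃ k : ℤ, (k : ℝ) = circleDisplacement γ := by
  obtain ⟨Γ, -, hΓ⟩ := exists_lift_path γ y.out (Quotient.out_eq y)
  have h : ((Γ 1 - Γ 0 : ℝ) : AddCircle (1 : ℝ)) = 0 := by
    rw [AddCircle.coe_sub, hΓ, hΓ, γ.source, γ.target, sub_self]
  obtain ⟨k, hk⟩ := (AddCircle.coe_eq_zero_iff (1 : ℝ)).1 h
  exact ⟨k, by rw [circleDisplacement_eq γ Γ hΓ, ← hk]; simp⟩

variable {X : Type} [TopologicalSpace X]

/-- The displacement of the homotopy class of a path with respect to a map to the circle. -/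
def displacement (f : C(X, AddCircle (1 : ℝ))) {y z : X} (p : Path.Homotopic.Quotient y z) : ℝ :=
  Quotient.lift (fun γ : Path y z => circleDisplacement (γ.map f.continuous))
    (fun _ _ h => circleDisplacement_congr (Path.Homotopic.map h f)) p

lemma displacement_mk (f : C(X, AddCircle (1 : ℝ))) {y z : X} (γ : Path y z) :
    displacement f (.mk γ) = circleDisplacement (γ.map f.continuous) := rfl

lemma displacement_trans (f : C(X, AddCircle (1 : ℝ))) {x y z : X}
    (p : Path.Homotopic.Quotient x y) (q : Path.Homotopic.Quotient y z) :
    displacement f (p.trans q) = displacement f p + displacement f q := by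
  induction p using Path.Homotopic.Quotient.ind with | mk γ =>
  induction q using Path.Homotopic.Quotient.ind with | mk γ' =>
  rw [← Path.Homotopic.Quotient.mk_trans, displacement_mk, Path.map_trans,
    circleDisplacement_trans, displacement_mk, displacement_mk]

lemma displacement_refl (f : C(X, AddCircle (1 : ℝ))) (x : X) :
    displacement f (.refl x) = 0 := by
  have := displacement_trans f (.refl x) (.refl x)
  rw [Path.Homotopic.Quotient.refl_trans] at this
  linarith

lemma displacement_symm (f : C(X, AddCircle (1 : ℝ))) {x y : X}
    (p : Path.Homotopic.Quotient x y) : displacement f p.symm = -displacement f p := by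
  have := displacement_trans f p p.symm
  rw [Path.Homotopic.Quotient.trans_symm, displacement_refl] at this
  linarith

lemma exists_int_displacement (f : C(X, AddCircle (1 : ℝ))) {x : X}
    (p : Path.Homotopic.Quotient x x) : ∃ k : ℤ, (k : ℝ) = displacement f p := by
  induction p using Path.Homotopic.Quotient.ind with | mk γ =>
  exact exists_int_circleDisplacement _

/-- The homomorphism `π₁(X, x) → ℤ` given by a map to the circle. -/
def windingHom (f : C(X, AddCircle (1 : ℝ))) (x : X) :
    FundamentalGroup X x →* Multiplicative ℤ :=
  MonoidHom.mk' (fun p => Multiplicative.ofAdd (exists_int_displacement f p).choose) fun p q => by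
    rw [← ofAdd_add]
    congr 1
    have h : ∀ r : FundamentalGroup X x,
        ((exists_int_displacement f r).choose : ℝ) = displacement f r :=
      fun r => (exists_int_displacement f r).choose_spec
    -- The product `p * q` in the fundamental group runs through `q` first.
    have : displacement f (p * q) = displacement f q + displacement f p := displacement_trans f q p
    rw [add_comm]
    exact_mod_cast (h _).trans (this.trans (congrArg₂ (· + ·) (h q).symm (h p).symm))

lemma windingHom_eq (f : C(X, AddCircle (1 : ℝ))) {x : X} (p : FundamentalGroup X x) :
    ((windingHom f x p).toAdd : ℝ) = displacement f p :=
  (exists_int_displacement f p).choose_spec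

/-! ### Holonomy along paths -/

variable [PathConnectedSpace X]

/-- The element of `π₁(X, x)` given by the inverse of a path, closed up by a fixed choice of paths
from `x`. -/
def holonomy (x : X) {y z : X} (p : Path.Homotopic.Quotient y z) : FundamentalGroup X x :=
  ((Path.Homotopic.Quotient.mk (PathConnectedSpace.somePath x z)).trans p.symm).trans
    (Path.Homotopic.Quotient.mk (PathConnectedSpace.somePath x y)).symm

lemma holonomy_refl (x y : X) : holonomy x (.refl y) = 1 := by
  have : Path.Homotopic.Quotient.symm (.refl y) = .refl y := by
    rw [← Path.Homotopic.Quotient.mk_refl, ← Path.Homotopic.Quotient.mk_symm, Path.refl_symm]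
  rw [holonomy, this, Path.Homotopic.Quotient.trans_refl, Path.Homotopic.Quotient.trans_symm]
  rfl

/-- Products in the fundamental group compose paths from right to left. The inverse path in
`holonomy` compensates for this, so the word read along a path keeps its order. -/
lemma holonomy_trans (x : X) {y z w : X} (p : Path.Homotopic.Quotient y z)
    (q : Path.Homotopic.Quotient z w) :
    holonomy x (p.trans q) = holonomy x p * holonomy x q := by
  induction p using Path.Homotopic.Quotient.ind with | mk γ =>
  induction q using Path.Homotopic.Quotient.ind with | mk γ' =>
  rw [FundamentalGroup.mul_def]
  simp only [holonomy, ← Path.Homotopic.Quotient.mk_trans, ← Path.Homotopic.Quotient.mk_symm,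
    Path.trans_symm]
  simp only [Path.Homotopic.Quotient.mk_trans, Path.Homotopic.Quotient.mk_symm,
    Path.Homotopic.Quotient.trans_assoc]
  rw [← Path.Homotopic.Quotient.trans_assoc _ (.mk (PathConnectedSpace.somePath x z)),
    Path.Homotopic.Quotient.symm_trans, Path.Homotopic.Quotient.refl_trans]

lemma holonomy_symm (x : X) {y z : X} (p : Path.Homotopic.Quotient y z) :
    holonomy x p.symm = (holonomy x p)⁻¹ := by
  rw [eq_inv_iff_mul_eq_one, ← holonomy_trans, Path.Homotopic.Quotient.symm_trans, holonomy_refl]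

/-- Serves for paths such as glued edges, whose endpoints agree on the surface but not
definitionally. -/
lemma holonomy_congr (x : X) {y z y' z' : X} {γ : Path y z} {γ' : Path y' z'}
    (h : ∀ t, γ t = γ' t) : holonomy x (.mk γ) = holonomy x (.mk γ') := by
  obtain rfl : y = y' := by rw [← γ.source, h, γ'.source]
  obtain rfl : z = z' := by rw [← γ.target, h, γ'.target]
  rw [show γ = γ' from Path.ext (funext h)]

lemma holonomy_eq_inv (x : X) {y z y' z' : X} {γ : Path y z} {γ' : Path y' z'}
    (h : ∀ t, γ t = γ' (σ t)) : holonomy x (.mk γ') = (holonomy x (.mk γ))⁻¹ := by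
  rw [← holonomy_symm, ← Path.Homotopic.Quotient.mk_symm]
  refine holonomy_congr x fun t => ?_
  rw [Path.symm_apply, Function.comp_apply, h, symm_symm]

/-- The winding number of the holonomy along a closed path. -/
lemma windingHom_holonomy (f : C(X, AddCircle (1 : ℝ))) (x : X) {y z : X} (hyz : y = z)
    (p : Path.Homotopic.Quotient y z) :
    ((windingHom f x (holonomy x p)).toAdd : ℝ) = -displacement f p := by
  -- For a closed path both auxiliary paths are the same, so their displacements cancel. The sign
  -- comes from the inverse in `holonomy`.
  subst hyz
  rw [windingHom_eq, holonomy, displacement_trans, displacement_trans, displacement_symm,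
    displacement_symm]
  ring

end Winding

/-! ### Functions on the polygon -/

section Trapezoid

/-- A function on the disk that, on the boundary divided into `m` edges of length `1`, is `1` at
distance at most `1 / 2` from the parameter `c`, vanishes at distance at least `3 / 2`, and is affine
in between. -/
def trapezoid (m : ℕ) (c : ℝ) (z : Metric.closedBall (0 : ℂ) 1) : ℝ :=
  max 0 (min 1 (3 / 2 - m / (2 * Real.pi) *
    Real.arccos (z.1 * Complex.exp (-(2 * Real.pi * (c / m) : ℝ) * Complex.I)).re))

lemma continuous_trapezoid (m : ℕ) (c : ℝ) : Continuous (trapezoid m c) := by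
  unfold trapezoid
  have := Real.continuous_arccos
  fun_prop

lemma trapezoid_edgePoint (m : ℕ) (c : ℝ) (k : ℕ) (t : unitInterval) :
    trapezoid m c (edgePoint m k t) = max 0 (min 1 (3 / 2 - m / (2 * Real.pi) *
      Real.arccos (Real.cos (2 * Real.pi * |(k : ℝ) + t - c| / m)))) := by
  have h : (2 * Real.pi * |(k : ℝ) + t - c| / m) = |2 * Real.pi * (k + t - c) / m| := by
    rw [abs_div, abs_mul, abs_of_pos Real.two_pi_pos, Nat.abs_cast]
  rw [h, Real.cos_abs, trapezoid, edgePoint]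
  simp only
  rw [← Complex.exp_add, ← Complex.exp_ofReal_mul_I_re]
  congr 7
  push_cast
  ring

lemma trapezoid_edgePoint_near {m : ℕ} (hm : 0 < m) {c : ℝ} {k : ℕ} {t : unitInterval}
    (h : |(k : ℝ) + t - c| ≤ m / 2) :
    trapezoid m c (edgePoint m k t) = max 0 (min 1 (3 / 2 - |(k : ℝ) + t - c|)) := by
  have hm' : (0 : ℝ) < m := by exact_mod_cast hm
  have hpi := Real.pi_pos
  rw [trapezoid_edgePoint, Real.arccos_cos (by positivity)]
  · congr 3
    field_simp
  · rw [div_le_iff₀ hm']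
    nlinarith

lemma trapezoid_edgePoint_far {m : ℕ} (hm : 0 < m) {c : ℝ} {k : ℕ} {t : unitInterval}
    (h₁ : 3 / 2 ≤ |(k : ℝ) + t - c|) (h₂ : |(k : ℝ) + t - c| ≤ m - 3 / 2) :
    trapezoid m c (edgePoint m k t) = 0 := by
  rcases le_total |(k : ℝ) + t - c| (m / 2) with h | h
  · rw [trapezoid_edgePoint_near hm h]
    exact max_eq_left (min_le_of_right_le (by linarith))
  have hm' : (0 : ℝ) < m := by exact_mod_cast hm
  have hpi := Real.pi_pos
  -- Beyond half the circumference `arccos` measures the distance around the other side, which is at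
  -- least `3 / 2` by `h₂`.
  have hcos : Real.cos (2 * Real.pi * |(k : ℝ) + t - c| / m) =
      Real.cos (2 * Real.pi * (m - |(k : ℝ) + t - c|) / m) := by
    rw [← Real.cos_two_pi_sub]
    congr 1
    field_simp
  rw [trapezoid_edgePoint, hcos, Real.arccos_cos]
  · refine max_eq_left (min_le_of_right_le ?_)
    have : (m : ℝ) / (2 * Real.pi) * (2 * Real.pi * (m - |(k : ℝ) + t - c|) / m) =
      m - |(k : ℝ) + t - c| := by field_simp
    linarith
  · have : 0 ≤ m - |(k : ℝ) + t - c| := by linarith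
    positivity
  · rw [div_le_iff₀ hm']
    nlinarith

variable {m : ℕ} (hm : 4 ≤ m) (k : ℕ) (t : unitInterval)
include hm

/-- The values of the trapezoid function centered at the edge `i + 1`. -/
lemma trapezoid_edgePoint_add (i : ℕ) :
    trapezoid m (i + 3 / 2) (edgePoint m i t) = t ∧
    trapezoid m (i + 3 / 2) (edgePoint m (i + 1) t) = 1 ∧
    trapezoid m (i + 3 / 2) (edgePoint m (i + 2) t) = 1 - t := by
  have hm' : (4 : ℝ) ≤ m := by exact_mod_cast hm
  have h0 := t.2.1
  have h1 := t.2.2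
  have e0 : |((i : ℕ) : ℝ) + t - (i + 3 / 2)| = 3 / 2 - t := by
    rw [abs_of_nonpos (by linarith)]; ring
  have e1 : |((i + 1 : ℕ) : ℝ) + t - (i + 3 / 2)| ≤ 1 / 2 := by
    push_cast
    rw [abs_le]; constructor <;> linarith
  have e2 : |((i + 2 : ℕ) : ℝ) + t - (i + 3 / 2)| = 1 / 2 + t := by
    push_cast
    rw [abs_of_nonneg (by linarith)]; ring
  refine ⟨?_, ?_, ?_⟩
  · rw [trapezoid_edgePoint_near (by omega) (by linarith), e0, min_eq_right (by linarith),
      max_eq_right (by linarith)]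
    ring
  · rw [trapezoid_edgePoint_near (by omega) (by linarith), min_eq_left (by linarith),
      max_eq_right (by linarith)]
  · rw [trapezoid_edgePoint_near (by omega) (by linarith), e2, min_eq_right (by linarith),
      max_eq_right (by linarith)]
    ring

lemma trapezoid_edgePoint_lt {i : ℕ} (hi : i ≤ 1) (hk : k < i) :
    trapezoid m (i + 3 / 2) (edgePoint m k t) = 0 := by
  obtain rfl : i = 1 := by omega
  obtain rfl : k = 0 := by omega
  have hm' : (4 : ℝ) ≤ m := by exact_mod_cast hm
  have h0 := t.2.1
  have h1 := t.2.2
  have e : |((0 : ℕ) : ℝ) + t - ((1 : ℕ) + 3 / 2)| = 5 / 2 - t := by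
    push_cast
    rw [abs_of_nonpos (by linarith)]; ring
  -- The distance lies between `3 / 2` and `5 / 2`; the upper bound `m - 3 / 2` is sharp for the
  -- square, `m = 4`.
  exact trapezoid_edgePoint_far (by omega) (by linarith) (by linarith)

lemma trapezoid_edgePoint_ge {i : ℕ} (hk : i + 3 ≤ k) (hkm : k < m) :
    trapezoid m (i + 3 / 2) (edgePoint m k t) = 0 := by
  have hk' : (i : ℝ) + 3 ≤ k := by exact_mod_cast hk
  have hkm' : (k : ℝ) + 1 ≤ m := by exact_mod_cast hkm
  have hi : (0 : ℝ) ≤ i := Nat.cast_nonneg i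
  have h0 := t.2.1
  have h1 := t.2.2
  have e : |(k : ℝ) + t - (i + 3 / 2)| = k + t - (i + 3 / 2) := abs_of_nonneg (by linarith)
  exact trapezoid_edgePoint_far (by omega) (by linarith) (by linarith)

end Trapezoid

/-! ### Loops on the surface and maps to the circle -/

section Surface

variable {g : ℕ}

/-- The projection of the polygon to the surface. -/
def polygonProj (g : ℕ) : C(Metric.closedBall (0 : ℂ) 1, ClosedSurface g) :=
  ⟨Quot.mk _, continuous_quot_mk⟩

instance : ContractibleSpace (Metric.closedBall (0 : ℂ) 1) :=
  (convex_closedBall (0 : ℂ) 1).contractibleSpace ⟨0, by simp⟩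

instance (g : ℕ) : PathConnectedSpace (ClosedSurface g) :=
  Function.Surjective.pathConnectedSpace (f := polygonProj g) Quot.mk_surjective
    (polygonProj g).continuous

lemma continuous_edgePoint (m k : ℕ) : Continuous (edgePoint m k) := by
  unfold edgePoint
  fun_prop

lemma edgePoint_one (m k : ℕ) : edgePoint m k 1 = edgePoint m (k + 1) 0 := by
  simp [edgePoint]

lemma edgePoint_self {m : ℕ} (hm : m ≠ 0) : edgePoint m m 0 = edgePoint m 0 0 := by
  have : (m : ℂ) ≠ 0 := by exact_mod_cast hm
  simp [edgePoint, this]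

/-- The `k`-th edge of the polygon. -/
def edgePath (m k : ℕ) : Path (edgePoint m k 0) (edgePoint m (k + 1) 0) where
  toFun := edgePoint m k
  continuous_toFun := continuous_edgePoint m k
  source' := rfl
  target' := edgePoint_one m k

/-- The holonomy in `π₁(S_g, x)` along the `k`-th edge. -/
def edgeHolonomy (x : ClosedSurface g) (k : ℕ) : surfaceGroup g x :=
  holonomy x (.mk ((edgePath (4 * g) k).map (polygonProj g).continuous))

lemma edgeHolonomy_inv_a (x : ClosedSurface g) {j : ℕ} (hj : j < g) :
    edgeHolonomy x (4 * j + 2) = (edgeHolonomy x (4 * j))⁻¹ :=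
  holonomy_eq_inv x fun t => Quot.sound (EdgeGluing.a j hj t)

lemma edgeHolonomy_inv_b (x : ClosedSurface g) {j : ℕ} (hj : j < g) :
    edgeHolonomy x (4 * j + 3) = (edgeHolonomy x (4 * j + 1))⁻¹ :=
  holonomy_eq_inv x fun t => Quot.sound (EdgeGluing.b j hj t)

/-- Makes the edges `a_j` and `b_j` loops on the surface, so that they have winding numbers. The
gluings at the endpoints link the vertices of one handle in the order `4j`, `4j + 3`, `4j + 2`, `4j
+ 1`. -/
lemma polygonProj_vertex {j : ℕ} (hj : j < g) :
    polygonProj g (edgePoint (4 * g) (4 * j) 0) = polygonProj g (edgePoint (4 * g) (4 * j + 1) 0) ∧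
    polygonProj g (edgePoint (4 * g) (4 * j + 1) 0) =
      polygonProj g (edgePoint (4 * g) (4 * j + 2) 0) := by
  have a0 : polygonProj g _ = polygonProj g _ := Quot.sound (EdgeGluing.a j hj 0)
  have a1 : polygonProj g _ = polygonProj g _ := Quot.sound (EdgeGluing.a j hj 1)
  have b1 : polygonProj g _ = polygonProj g _ := Quot.sound (EdgeGluing.b j hj 1)
  rw [unitInterval.symm_zero, edgePoint_one] at a0
  rw [unitInterval.symm_one, edgePoint_one] at a1 b1
  exact ⟨a0.trans (b1.symm.trans a1.symm), a1⟩

/-- The holonomy along a path in the polygon. -/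
def polygonHolonomy (x : ClosedSurface g) (y z : Metric.closedBall (0 : ℂ) 1) : surfaceGroup g x :=
  holonomy x (.mk ((PathConnectedSpace.somePath y z).map (polygonProj g).continuous))

/-- The disk is simply connected, so the choice of path is irrelevant. This is how the boundary word
becomes trivial in `π₁`. -/
lemma polygonHolonomy_eq (x : ClosedSurface g) {y z : Metric.closedBall (0 : ℂ) 1}
    (γ : Path y z) :
    polygonHolonomy x y z = holonomy x (.mk (γ.map (polygonProj g).continuous)) :=
  congrArg (holonomy x) (Path.Homotopic.Quotient.eq.2
    ((SimplyConnectedSpace.paths_homotopic _ γ).map (polygonProj g)))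

lemma polygonHolonomy_self (x : ClosedSurface g) (y : Metric.closedBall (0 : ℂ) 1) :
    polygonHolonomy x y y = 1 := by
  rw [polygonHolonomy_eq x (Path.refl y), ← holonomy_refl x (polygonProj g y)]
  rfl

lemma polygonHolonomy_succ (x : ClosedSurface g) (y : Metric.closedBall (0 : ℂ) 1) (k : ℕ) :
    polygonHolonomy x y (edgePoint (4 * g) (k + 1) 0) =
      polygonHolonomy x y (edgePoint (4 * g) k 0) * edgeHolonomy x k := by
  rw [polygonHolonomy_eq x ((PathConnectedSpace.somePath y _).trans (edgePath (4 * g) k)),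
    Path.map_trans, Path.Homotopic.Quotient.mk_trans, holonomy_trans]
  rfl

/-- The 2-cycle of the boundary word of the polygon. -/
lemma exists_surfaceCycle (hg : 1 ≤ g) (x : ClosedSurface g) :
    ∃ z : groupHomology.cycles₂ (trivialZ (surfaceGroup g x)),
      ∀ φ ψ : surfaceGroup g x →* Multiplicative ℤ,
        evalChain (fun p => (ψ p.1).toAdd * (φ p.2).toAdd) z.1 = ∑ j ∈ Finset.range g,
          ((ψ (edgeHolonomy x (4 * j))).toAdd * (φ (edgeHolonomy x (4 * j + 1))).toAdd -
            (ψ (edgeHolonomy x (4 * j + 1))).toAdd * (φ (edgeHolonomy x (4 * j))).toAdd) := by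
  refine exists_commutatorCycle (fun j => edgeHolonomy x (4 * j))
    (fun j => edgeHolonomy x (4 * j + 1))
    (fun j => polygonHolonomy x (edgePoint (4 * g) 0 0) (edgePoint (4 * g) (4 * j) 0))
    (polygonHolonomy_self x _) (fun j hj => ?_) ?_
  · change polygonHolonomy x _ (edgePoint (4 * g) (4 * j + 3 + 1) 0) = _
    rw [polygonHolonomy_succ, polygonHolonomy_succ, polygonHolonomy_succ, polygonHolonomy_succ,
      edgeHolonomy_inv_a x hj, edgeHolonomy_inv_b x hj]
    simp only [mul_assoc]
  · rw [edgePoint_self (by omega), polygonHolonomy_self]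

/-! ### Homomorphisms dual to the first two edges -/

/-- Trapezoid functions modulo `1` respect the edge identifications. -/
lemma trapezoid_gluing (hg : 1 ≤ g) {i : ℕ} (hi : i ≤ 1) {p q : Metric.closedBall (0 : ℂ) 1}
    (h : EdgeGluing g p q) :
    (trapezoid (4 * g) (i + 3 / 2) p : AddCircle (1 : ℝ)) = trapezoid (4 * g) (i + 3 / 2) q := by
  have hm : 4 ≤ 4 * g := by omega
  have h10 : ((1 : ℝ) : AddCircle (1 : ℝ)) = ((0 : ℝ) : AddCircle (1 : ℝ)) := by
    rw [AddCircle.coe_period, AddCircle.coe_zero]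
  cases h with
  | a j hj t =>
    -- On the edges `0, 1, 2, 3` the function is `t, 1, 1 - t, 0` for `i = 0` and `0, t, 1, 1 - t`
    -- for `i = 1`; on all later edges it is `0`. The constants `0` and `1` on a glued pair agree
    -- only in the circle.
    rcases Nat.eq_zero_or_pos j with rfl | hj0
    · interval_cases i
      · rw [(trapezoid_edgePoint_add hm t _).1, (trapezoid_edgePoint_add hm _ _).2.2,
          unitInterval.coe_symm_eq, sub_sub_cancel]
      · rw [trapezoid_edgePoint_lt hm _ t hi (by omega), (trapezoid_edgePoint_add hm _ _).2.1, h10]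
    · rw [trapezoid_edgePoint_ge hm _ _ (by omega) (by omega),
        trapezoid_edgePoint_ge hm _ _ (by omega) (by omega)]
  | b j hj t =>
    rcases Nat.eq_zero_or_pos j with rfl | hj0
    · interval_cases i
      · rw [(trapezoid_edgePoint_add hm t _).2.1, trapezoid_edgePoint_ge hm _ _ (by omega)
          (by omega), h10]
      · rw [(trapezoid_edgePoint_add hm t _).1, (trapezoid_edgePoint_add hm _ _).2.2,
          unitInterval.coe_symm_eq, sub_sub_cancel]
    · rw [trapezoid_edgePoint_ge hm _ _ (by omega) (by omega),
        trapezoid_edgePoint_ge hm _ _ (by omega) (by omega)]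

/-- The map from the surface to the circle given by a trapezoid function on the polygon. -/
def surfaceToCircle (hg : 1 ≤ g) {i : ℕ} (hi : i ≤ 1) :
    C(ClosedSurface g, AddCircle (1 : ℝ)) where
  toFun := Quot.lift (fun p => (trapezoid (4 * g) (i + 3 / 2) p : AddCircle (1 : ℝ)))
    fun _ _ h => trapezoid_gluing hg hi h
  continuous_toFun := continuous_quot_lift _
    ((AddCircle.continuous_mk' 1).comp (continuous_trapezoid _ _))

/-- The homomorphisms from the surface group to `ℤ` that count crossings of one of the first two
edges. -/
def edgeHom (hg : 1 ≤ g) (x : ClosedSurface g) {i : ℕ} (hi : i ≤ 1) :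
    surfaceGroup g x →* Multiplicative ℤ :=
  windingHom (surfaceToCircle hg hi) x

/-- The trapezoid function, real valued on the polygon, is itself a lift along the edge. Start minus
end appears because holonomy inverts paths. -/
lemma edgeHom_edgeHolonomy (hg : 1 ≤ g) (x : ClosedSurface g) {i : ℕ} (hi : i ≤ 1) {k : ℕ}
    (hk : polygonProj g (edgePoint (4 * g) k 0) = polygonProj g (edgePoint (4 * g) (k + 1) 0)) :
    ((edgeHom hg x hi (edgeHolonomy x k)).toAdd : ℝ) =
      trapezoid (4 * g) (i + 3 / 2) (edgePoint (4 * g) k 0) -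
        trapezoid (4 * g) (i + 3 / 2) (edgePoint (4 * g) k 1) := by
  rw [edgeHom, edgeHolonomy, windingHom_holonomy _ _ hk, displacement_mk,
    circleDisplacement_eq _ ⟨fun t => trapezoid (4 * g) (i + 3 / 2) (edgePoint (4 * g) k t),
      (continuous_trapezoid _ _).comp (continuous_edgePoint _ _)⟩ fun t => rfl]
  simp

lemma edgeHom_edgeHolonomy_a (hg : 1 ≤ g) (x : ClosedSurface g) {i : ℕ} (hi : i ≤ 1) {j : ℕ}
    (hj : j < g) :
    (edgeHom hg x hi (edgeHolonomy x (4 * j))).toAdd = if j = 0 ∧ i = 0 then -1 else 0 := by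
  have hm : 4 ≤ 4 * g := by omega
  have h := edgeHom_edgeHolonomy hg x hi (polygonProj_vertex hj).1
  rcases Nat.eq_zero_or_pos j with rfl | hj0
  · interval_cases i
    · rw [(trapezoid_edgePoint_add hm _ _).1, (trapezoid_edgePoint_add hm _ _).1] at h
      simp at h
      exact_mod_cast h
    · rw [trapezoid_edgePoint_lt hm _ _ hi (by omega), trapezoid_edgePoint_lt hm _ _ hi (by omega),
        sub_self] at h
      exact_mod_cast h
  · rw [trapezoid_edgePoint_ge hm _ _ (by omega) (by omega),
        trapezoid_edgePoint_ge hm _ _ (by omega) (by omega), sub_self] at h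
    rw [if_neg (by omega)]
    exact_mod_cast h

lemma edgeHom_edgeHolonomy_b (hg : 1 ≤ g) (x : ClosedSurface g) {i : ℕ} (hi : i ≤ 1) {j : ℕ}
    (hj : j < g) :
    (edgeHom hg x hi (edgeHolonomy x (4 * j + 1))).toAdd =
      if j = 0 ∧ i = 1 then -1 else 0 := by
  have hm : 4 ≤ 4 * g := by omega
  have h := edgeHom_edgeHolonomy hg x hi (polygonProj_vertex hj).2
  rcases Nat.eq_zero_or_pos j with rfl | hj0
  · interval_cases i
    · rw [(trapezoid_edgePoint_add hm _ _).2.1, (trapezoid_edgePoint_add hm _ _).2.1,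
        sub_self] at h
      exact_mod_cast h
    · rw [(trapezoid_edgePoint_add hm _ _).1, (trapezoid_edgePoint_add hm _ _).1] at h
      simp at h
      exact_mod_cast h
  · rw [trapezoid_edgePoint_ge hm _ _ (by omega) (by omega),
        trapezoid_edgePoint_ge hm _ _ (by omega) (by omega), sub_self] at h
    rw [if_neg (by omega)]
    exact_mod_cast h

/-- There is a homology class with arbitrary Euler numbers. -/
lemma exists_eulerNumber_eq (hg : 1 ≤ g) (x : ClosedSurface g) :
    ∃ y : groupHomology.H2 (trivialZ (surfaceGroup g x)),
      ∀ n : ℤ, ∃ ρ : surfaceGroup g x →* HomeoPlus, eulerNumber ρ y = n := by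
  obtain ⟨z, hz⟩ := exists_surfaceCycle hg x
  refine ⟨(groupHomology.H2π (trivialZ (surfaceGroup g x))).hom z, fun n =>
    ⟨spiralAction.comp (((edgeHom hg x zero_le_one) ^ (-n)).prod (edgeHom hg x le_rfl)), ?_⟩⟩
  -- On the first handle `ψ` is `0` on `a` and `-1` on `b`, while `φ` is `(-n) * (-1) = n` on `a`.
  -- The intersection term is therefore `-(-1) * n = n`. On the other handles `ψ` vanishes.
  rw [eulerNumber_spiralAction, hz, Finset.sum_eq_single_of_mem 0 (Finset.mem_range.2 hg)]
  · have a := edgeHom_edgeHolonomy_a hg x zero_le_one hg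
    have b := edgeHom_edgeHolonomy_b hg x le_rfl hg
    have a' := edgeHom_edgeHolonomy_a hg x le_rfl hg
    simp only [MonoidHom.zpow_apply, toAdd_zpow, a, b, a']
    simp
  · intro j hj hj0
    have hj := Finset.mem_range.1 hj
    rw [edgeHom_edgeHolonomy_a hg x le_rfl hj, edgeHom_edgeHolonomy_b hg x le_rfl hj]
    simp [hj0]

end Surface

end

/-! ### From the polygon class to a fundamental class -/

theorem theorem2p5 (g : ℕ) (hg : 1 ≤ g) (x : ClosedSurface g)
    (c : groupHomology.H2 (trivialZ (surfaceGroup g x))) (hc : IsFundamentalClass c) (n : ℤ) :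
    ∃ ρ : surfaceGroup g x →* HomeoPlus, eulerNumber ρ c = n := by
  obtain ⟨y, hy⟩ := exists_eulerNumber_eq hg x
  obtain ⟨k, hk⟩ := Submodule.mem_span_singleton.1
    (hc ▸ Submodule.mem_top : y ∈ Submodule.span ℤ {c})
  have hlin : ∀ ρ : surfaceGroup g x →* HomeoPlus, eulerNumber ρ y = k * eulerNumber ρ c :=
    fun ρ => by
      rw [← hk]
      exact LinearMap.map_smul (kronecker (pullbackH2 ρ eulerClass)) k c
  simp only [hlin] at hy
  -- The value `1` serves only to show `k ≠ 0`, which allows cancelling `k` from `k * eulerNumber ρ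
  -- c = k * n`.
  obtain ⟨ρ₁, h₁⟩ := hy 1
  obtain ⟨ρ, hρ⟩ := hy (k * n)
  exact ⟨ρ, mul_left_cancel₀ (left_ne_zero_of_mul_eq_one h₁) hρ⟩
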